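/- Let $\Omega\subset\mathbb{R}^n$ be open and let $\mathcal{J}=(\mathcal{J}^{ij})$ be a smooth Poisson operator on $\Omega$, i.e. a smooth antisymmetric matrix field with $\sum_l(\mathcal{J}^{il}\partial_l\mathcal{J}^{jk}+\mathcal{J}^{jl}\partial_l\mathcal{J}^{ki}+\mathcal{J}^{kl}\partial_l\mathcal{J}^{ij})=0$. Let $n=2r+m$. Smooth local coordinates $z=(p^1,\dots,p^r,q^1,\dots,q^r,C^1,\dots,C^m)$ on an open set $U\subset\Omega$ are called Lie--Darboux coordinates if, on $U$, $\mathcal{J}=\sum_{i=1}^r\partial_{q^i}\wedge\partial_{p^i}$ (with $u\wedge v=u\otimes v-v\otimes u$) and the $C^k$ are Casimir invariants, $\mathcal{J}^{ij}\partial_jC^k=0$. In such coordinates, the dissipative tensor is $g=\sum_{a,b}g^{ab}\,\partial_{z^a}\otimes\partial_{z^b}$ with $g^{ab}=\sum_c\mathcal{J}^{ac}\mathcal{J}^{bc}$, where $\mathcal{J}^{ab}$ are the components of $\mathcal{J}$ in the coordinates $z$. 1. Every point of $\Omega$ around which the rank of $\mathcal{J}$ is constantly $2r$ has a neighborhood $U\subset\Omega$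 with Lie--Darboux coordinates. 2. In all Lie--Darboux coordinates on an open set $U\subset\Omega$, at every point of $U$, $$g=\sum_{i=1}^r\left(\partial_{p^i}\otimes\partial_{p^i}+\partial_{q^i}\otimes\partial_{q^i}\right).$$ On the tangent spaces $T=\bigcap_k\ker dC^k$ of the Casimir leaves $\{C^1=c^1,\dots,C^m=c^m\}\subset U$, $g$ is invertible: the unique twice covariant tensor $\mathfrak{g}$ that is inverse to $g$ on $T$ and vanishes whenever one of its arguments is some $\partial_{C^k}$ is $$\mathfrak{g}=\sum_{i=1}^r\left(dp^i\otimes dp^i+dq^i\otimes dq^i\right).$$ It is symmetric and positive definite on $T$, and it is a Euclidean metric on each Casimir leaf: $(p,q)$ is a diffeomorphism of the leaf in $U$ onto an open subset of $\mathbb{R}^{2r}$ that carries $\mathfrak{g}$ to the Euclidean metric. 3. If $n=2$, $r=1$, $m=0$, then in Lie--Darboux coordinates $(p,q)$ the matrix of $\mathcal{J}$ is $\begin{bmatrix}0&-1\\1&0\end{bmatrix}$, and $g=\partial_p\otimes\partial_p+\partial_q\otimes\partial_q$ has the matrix $g=-\mathcal{J}^2=I$. Its inverse is $\mathfrak{g}=dp\otimes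 dp+dq\otimes dq$, a metric tensor on the whole phase space. -/

import Mathlib

open scoped ContDiff Topology TensorProduct

noncomputable section

namespace LieDarboux

/-! ### Second-order tensors on a finite-dimensional real vector space -/

section Tensors

variable {E : Type*} [AddCommGroup E] [Module ℝ E]

/-- The value `h(v, w)` of a twice covariant tensor on two vectors. -/
def cotensorEval (h : Module.Dual ℝ E ⊗[ℝ] Module.Dual ℝ E) (v w : E) : ℝ :=
  TensorProduct.dualDistrib ℝ E E h (v ⊗ₜ[ℝ] w)

/-- Index raising: the contraction of `g = ∑ u ⊗ v` with a covector `α`, i.e. `∑ α(u) v`. -/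
def sharp (g : E ⊗[ℝ] E) (α : Module.Dual ℝ E) : E :=
  TensorProduct.lid ℝ E (LinearMap.rTensor E α g)

/-- Index lowering: the contraction of `h = ∑ α ⊗ β` with a vector `v`, i.e. `∑ α(v) β`. -/
def flat (h : Module.Dual ℝ E ⊗[ℝ] Module.Dual ℝ E) (v : E) : Module.Dual ℝ E :=
  TensorProduct.lid ℝ (Module.Dual ℝ E)
    (LinearMap.rTensor (Module.Dual ℝ E) (Module.Dual.eval ℝ E v) h)

/-- The twice covariant tensor `h` and the twice contravariant tensor `g` are inverse to each
other on the subspace `T`: as maps `T → E*/ann(T) = T*` and `T* → T`, lowering with `h` and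
raising with `g` are mutually inverse. For `T = ⊤` this is the inverse in the usual sense. -/
def IsInverseOn (T : Submodule ℝ E) (g : E ⊗[ℝ] E)
    (h : Module.Dual ℝ E ⊗[ℝ] Module.Dual ℝ E) : Prop :=
  (∀ α : Module.Dual ℝ E, sharp g α ∈ T) ∧
  (∀ v ∈ T, sharp g (flat h v) = v) ∧
  (∀ α : Module.Dual ℝ E, ∀ v ∈ T, flat h (sharp g α) v = α v)

/-- `h` is a (positive definite) scalar product on the subspace `T`. -/
def IsMetricOn (T : Submodule ℝ E) (h : Module.Dual ℝ E ⊗[ℝ] Module.Dual ℝ E) : Prop :=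
  (∀ v ∈ T, ∀ w ∈ T, cotensorEval h v w = cotensorEval h w v) ∧
  (∀ v ∈ T, v ≠ 0 → 0 < cotensorEval h v v)

end Tensors

/-! ### Poisson operators on `ℝⁿ` -/

/-- The partial derivative `∂f/∂xⁱ`. -/
def partialDeriv {n : ℕ} (i : Fin n) (f : (Fin n → ℝ) → ℝ) (x : Fin n → ℝ) : ℝ :=
  fderiv ℝ f x (Pi.single i 1)

/-- `J` is a smooth Poisson operator on `Ω`: a smooth antisymmetric matrix field that satisfies
the Jacobi identity. -/
structure IsPoissonOn {n : ℕ} (J : (Fin n → ℝ) → Matrix (Fin n) (Fin n) ℝ)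
    (Ω : Set (Fin n → ℝ)) : Prop where
  smooth : ∀ i j, ContDiffOn ℝ ∞ (fun x => J x i j) Ω
  antisymm : ∀ x ∈ Ω, ∀ i j, J x i j = -J x j i
  jacobi : ∀ x ∈ Ω, ∀ i j k,
    ∑ l, (J x i l * partialDeriv l (fun y => J y j k) x
        + J x j l * partialDeriv l (fun y => J y k i) x
        + J x k l * partialDeriv l (fun y => J y i j) x) = 0

/-- The bivector `J^{ij} ∂_i ⊗ ∂_j` with Cartesian components `A = (J^{ij})`. -/
def bivector {n : ℕ} (A : Matrix (Fin n) (Fin n) ℝ) : (Fin n → ℝ) ⊗[ℝ] (Fin n → ℝ) :=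
  ∑ i, ∑ j, A i j • ((Pi.single i 1 : Fin n → ℝ) ⊗ₜ[ℝ] (Pi.single j 1 : Fin n → ℝ))

/-! ### Coordinate charts `(p¹, …, pʳ, q¹, …, qʳ, C¹, …, Cᵐ)` -/

/-- The index set of the coordinates `(p, q, C)`. -/
abbrev Idx (r m : ℕ) : Type := Fin r ⊕ (Fin r ⊕ Fin m)

/-- The index of the coordinate `pⁱ`. -/
abbrev pIdx {r m : ℕ} (i : Fin r) : Idx r m := Sum.inl i

/-- The index of the coordinate `qⁱ`. -/
abbrev qIdx {r m : ℕ} (i : Fin r) : Idx r m := Sum.inr (Sum.inl i)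

/-- The index of the coordinate `Cᵏ`. -/
abbrev cIdx {r m : ℕ} (k : Fin m) : Idx r m := Sum.inr (Sum.inr k)

/-- A local chart of `ℝⁿ` (a homeomorphism from the open set `z.source` onto the open set
`z.target`) with coordinates named `(p, q, C)`. -/
abbrev Chart (n r m : ℕ) := OpenPartialHomeomorph (Fin n → ℝ) (Idx r m → ℝ)

variable {n r m : ℕ}

/-- The coordinate covector `dzᵃ` at `x`. -/
def dCoord (z : Chart n r m) (a : Idx r m) (x : Fin n → ℝ) : Module.Dual ℝ (Fin n → ℝ) :=
  (fderiv ℝ (fun y => z y a) x).toLinearMap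

/-- The coordinate tangent vector `∂/∂zᵃ` at `x`. -/
def coordVec (z : Chart n r m) (a : Idx r m) (x : Fin n → ℝ) : Fin n → ℝ :=
  fderiv ℝ z.symm (z x) (Pi.single a 1)

/-- `z = (p, q, C)` are Lie–Darboux coordinates for `J` on the open set `z.source`: they are
smooth coordinates, `J = ∑ᵢ ∂_{qⁱ} ∧ ∂_{pⁱ}`, where `u ∧ v = u ⊗ v - v ⊗ u`, and the `Cᵏ` are
Casimir invariants of `J`. -/
structure IsLieDarboux (J : (Fin n → ℝ) → Matrix (Fin n) (Fin n) ℝ) (z : Chart n r m) :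
    Prop where
  smooth : ContDiffOn ℝ ∞ z z.source
  smooth_symm : ContDiffOn ℝ ∞ z.symm z.target
  canonical : ∀ x ∈ z.source, bivector (J x) =
    ∑ i : Fin r, (coordVec z (qIdx i) x ⊗ₜ[ℝ] coordVec z (pIdx i) x
      - coordVec z (pIdx i) x ⊗ₜ[ℝ] coordVec z (qIdx i) x)
  casimir : ∀ x ∈ z.source, ∀ (k : Fin m) (i : Fin n),
    ∑ j, J x i j * partialDeriv j (fun y => z y (cIdx k)) x = 0

/-! ### The dissipative tensor -/

/-- The components `J^{ab} = ∂_i zᵃ J^{ij} ∂_j zᵇ` of `J` in the coordinates `z`. -/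
def chartComponents (J : (Fin n → ℝ) → Matrix (Fin n) (Fin n) ℝ) (z : Chart n r m)
    (x : Fin n → ℝ) : Matrix (Idx r m) (Idx r m) ℝ :=
  fun a b => ∑ i, ∑ j, partialDeriv i (fun y => z y a) x * J x i j *
    partialDeriv j (fun y => z y b) x

/-- The dissipative components `g^{ab} = J^{ac} J^{bc}` (summed over `c`) formed from the
components of a Poisson operator in a given coordinate system. -/
def dissipativeMatrix {ι : Type*} [Fintype ι] (A : Matrix ι ι ℝ) : Matrix ι ι ℝ :=
  fun a b => ∑ c, A a c * A b c

/-- The dissipative tensor `g = g^{ab} ∂_a ⊗ ∂_b`, where `g^{ab} = J^{ac} J^{bc}` is formed in the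
coordinates `z`. (The index contraction uses the Euclidean metric of the coordinates in use, so
that `g` depends on the coordinate system.) -/
def dissipativeTensor (J : (Fin n → ℝ) → Matrix (Fin n) (Fin n) ℝ) (z : Chart n r m)
    (x : Fin n → ℝ) : (Fin n → ℝ) ⊗[ℝ] (Fin n → ℝ) :=
  ∑ a, ∑ b, dissipativeMatrix (chartComponents J z x) a b •
    (coordVec z a x ⊗ₜ[ℝ] coordVec z b x)

/-- `∑ᵢ (∂_{pⁱ} ⊗ ∂_{pⁱ} + ∂_{qⁱ} ⊗ ∂_{qⁱ})` at `x`. -/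
def canonicalContra (z : Chart n r m) (x : Fin n → ℝ) : (Fin n → ℝ) ⊗[ℝ] (Fin n → ℝ) :=
  ∑ i : Fin r, (coordVec z (pIdx i) x ⊗ₜ[ℝ] coordVec z (pIdx i) x
    + coordVec z (qIdx i) x ⊗ₜ[ℝ] coordVec z (qIdx i) x)

/-- `∑ᵢ (dpⁱ ⊗ dpⁱ + dqⁱ ⊗ dqⁱ)` at `x`. -/
def canonicalMetric (z : Chart n r m) (x : Fin n → ℝ) :
    Module.Dual ℝ (Fin n → ℝ) ⊗[ℝ] Module.Dual ℝ (Fin n → ℝ) :=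
  ∑ i : Fin r, (dCoord z (pIdx i) x ⊗ₜ[ℝ] dCoord z (pIdx i) x
    + dCoord z (qIdx i) x ⊗ₜ[ℝ] dCoord z (qIdx i) x)

/-! ### Casimir leaves -/

/-- The local Casimir leaf `{x | C¹ = c¹, …, Cᵐ = cᵐ}` in the domain of the chart. -/
def casimirLeaf (z : Chart n r m) (c : Fin m → ℝ) : Set (Fin n → ℝ) :=
  {x | x ∈ z.source ∧ ∀ k, z x (cIdx k) = c k}

/-- The tangent space at `x` of the Casimir leaf through `x`. -/
def leafTangent (z : Chart n r m) (x : Fin n → ℝ) : Submodule ℝ (Fin n → ℝ) :=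
  ⨅ k : Fin m, LinearMap.ker (dCoord z (cIdx k) x)

/-- The coordinates `(p, q)`, as a map to `ℝ²ʳ`. -/
def leafCoord (z : Chart n r m) (x : Fin n → ℝ) : Fin r ⊕ Fin r → ℝ :=
  Sum.elim (fun i => z x (pIdx i)) (fun i => z x (qIdx i))

/-- The field `h` of twice covariant tensors restricts to a Euclidean metric on the Casimir leaf
`C = c`, with Euclidean coordinates `(p, q)`: `(p, q)` is a diffeomorphism of the leaf onto an
open subset of `ℝ²ʳ` that carries `h` to the Euclidean metric of `ℝ²ʳ`. -/
def IsEuclideanOnLeaf (z : Chart n r m) (c : Fin m → ℝ)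
    (h : (Fin n → ℝ) → Module.Dual ℝ (Fin n → ℝ) ⊗[ℝ] Module.Dual ℝ (Fin n → ℝ)) : Prop :=
  IsOpen (leafCoord z '' casimirLeaf z c) ∧
  ContDiffOn ℝ ∞ (leafCoord z) (casimirLeaf z c) ∧
  (∃ σ : (Fin r ⊕ Fin r → ℝ) → (Fin n → ℝ),
    ContDiffOn ℝ ∞ σ (leafCoord z '' casimirLeaf z c) ∧
    ∀ x ∈ casimirLeaf z c, σ (leafCoord z x) = x) ∧
  (∀ x ∈ casimirLeaf z c,
    Set.BijOn (fderiv ℝ (leafCoord z) x) (leafTangent z x) Set.univ ∧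
    ∀ v ∈ leafTangent z x, ∀ w ∈ leafTangent z x,
      cotensorEval (h x) v w =
        ∑ s, fderiv ℝ (leafCoord z) x v s * fderiv ℝ (leafCoord z) x w s)

end LieDarboux

end

/-!
Everything rests on Darboux's theorem for Poisson operators of constant rank. The rest is linear
algebra in the frame `∂/∂zᵃ` of a Lie–Darboux chart: there `J` has the canonical constant matrix,
so `J Jᵀ` is the orthogonal projection onto the `(p, q)` directions, and these span the tangent
spaces of the Casimir leaves.

For the existence of the chart, `J` is viewed as a bivector field `P : E → (E* → E)`, and
canonical pairs are split off one at a time (`CanonicalPairs.exists_succ`) without ever leaving the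
space `E`. Suppose that linear functionals `pᵢ, qᵢ` already have constant Hamiltonian fields
`P pᵢ = vᵢ`, `P qᵢ = -uᵢ`. If the rank is not exhausted, some linear functional `α` vanishes on all
`uᵢ, vᵢ` and has `P α ≠ 0` at the base point. By the Jacobi identity the field `P α` is constant
along the `uᵢ, vᵢ`, and by antisymmetry it is annihilated by the `pᵢ, qᵢ` and by `α`. A vector field
with these properties can be straightened by a local diffeomorphism that respects all the linear
data (`exists_straightening`). After this `P α = V` is constant. For a linear functional `μ` with
`μ V = 1` the field `P μ` is straightened in the same way, with `α` as the time, and `(α, μ)` is a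
new canonical pair. Once there are `r` pairs and the rank is `2r`, functionals that vanish on the
`uᵢ, vᵢ` are Casimir invariants, and a linear change of coordinates finishes the construction
(`exists_isLieDarboux`).

The analytic input is the smooth dependence of the flow of a vector field on time and initial value
(`exists_smooth_flow`). It is obtained from the inverse function theorem in the Banach space
`(ℝ × E) × C([0,1], E)`, applied to the integral equation `u = y + t ∫ X(u)`: superposition with a
smooth map is a smooth operator on spaces of continuous functions (`contDiff_superposition`).
-/

namespace LieDarboux

universe u

/-! ### Superposition operators on spaces of continuous maps -/

section Superposition

variable {K : Type*} [TopologicalSpace K] [CompactSpace K]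
  {E F : Type u} [NormedAddCommGroup E] [NormedSpace ℝ E] [NormedAddCommGroup F] [NormedSpace ℝ F]

/-- Pointwise application `(A, u) ↦ (s ↦ A s (u s))` as a bounded bilinear map. -/
noncomputable def pointwiseApply (K : Type*) [TopologicalSpace K] [CompactSpace K] (E F : Type u)
    [NormedAddCommGroup E] [NormedSpace ℝ E] [NormedAddCommGroup F] [NormedSpace ℝ F] :
    C(K, E →L[ℝ] F) →L[ℝ] C(K, E) →L[ℝ] C(K, F) :=
  LinearMap.mkContinuous₂
    (LinearMap.mk₂ ℝ (fun (A : C(K, E →L[ℝ] F)) (u : C(K, E)) =>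
        (⟨fun s => A s (u s), by fun_prop⟩ : C(K, F)))
      (fun A B u => by ext s; simp) (fun c A u => by ext s; simp)
      (fun A u w => by ext s; simp) (fun c A u => by ext s; simp))
    1 (fun A u => by
      refine (ContinuousMap.norm_le _ (by positivity)).2 fun s => ?_
      rw [one_mul]
      exact ((A s).le_opNorm (u s)).trans
        (mul_le_mul (A.norm_coe_le_norm s) (u.norm_coe_le_norm s) (norm_nonneg _) (norm_nonneg A)))

/-- The superposition operator `u ↦ X ∘ u` of a `C¹` map `X` is differentiable, with derivative
`h ↦ (DX ∘ u) h`: the superposition operator of `DX` is continuous in the sup norm, which makes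
the error in the pointwise Taylor formula uniform. -/
lemma hasFDerivAt_superposition (X : C(E, F)) (hX : Differentiable ℝ X) (D : C(E, E →L[ℝ] F))
    (hD : ∀ x, D x = fderiv ℝ X x) (u : C(K, E)) :
    HasFDerivAt (fun w : C(K, E) => X.comp w) (pointwiseApply K E F (D.comp u)) u := by
  rw [hasFDerivAt_iff_isLittleO_nhds_zero, Asymptotics.isLittleO_iff]
  intro c hc
  have hcont : Continuous (fun w : C(K, E) => D.comp w) := ContinuousMap.continuous_postcomp D
  obtain ⟨δ, hδ, hball⟩ :=
    (Metric.continuousAt_iff (f := fun w : C(K, E) => D.comp w)).1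
      (hcont.continuousAt (x := u)) c hc
  filter_upwards [Metric.ball_mem_nhds (0 : C(K, E)) hδ] with h hh
  rw [mem_ball_zero_iff] at hh
  refine (ContinuousMap.norm_le _ (by positivity)).2 fun s => ?_
  have hbound : ∀ y ∈ Metric.ball (u s) δ, ‖fderiv ℝ X y - D (u s)‖ ≤ c := by
    intro y hy
    have h1 : dist (u + ContinuousMap.const K (y - u s)) u < δ := by
      rw [dist_eq_norm, add_sub_cancel_left]
      refine lt_of_le_of_lt ?_ (mem_ball_iff_norm.1 hy)
      exact (ContinuousMap.norm_le _ (norm_nonneg _)).2 fun _ => le_rfl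
    have h2 := (ContinuousMap.dist_apply_le_dist s).trans (hball h1).le
    simpa [dist_eq_norm, hD] using h2
  have hus : u s + h s ∈ Metric.ball (u s) δ := by
    rw [mem_ball_iff_norm, add_sub_cancel_left]
    exact (h.norm_coe_le_norm s).trans_lt hh
  have key := Convex.norm_image_sub_le_of_norm_hasFDerivWithin_le'
    (fun y _ => (hX y).hasFDerivAt.hasFDerivWithinAt) hbound (convex_ball (u s) δ)
    (Metric.mem_ball_self hδ) hus
  rw [add_sub_cancel_left] at key
  exact key.trans (mul_le_mul_of_nonneg_left (h.norm_coe_le_norm s) hc.le)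

lemma contDiff_nat_superposition (n : ℕ) (X : C(E, F)) (hX : ContDiff ℝ n X) :
    ContDiff ℝ n (fun w : C(K, E) => X.comp w) := by
  induction n generalizing F with
  | zero => exact contDiff_zero.2 (ContinuousMap.continuous_postcomp X)
  | succ n ih =>
    have hX' : ContDiff ℝ ((n : ℕ∞ω) + 1) X := by exact_mod_cast hX
    obtain ⟨hdiff, -, hfd⟩ := contDiff_succ_iff_fderiv.1 hX'
    let D : C(E, E →L[ℝ] F) := ⟨fderiv ℝ X, hfd.continuous⟩
    have hder := fun u : C(K, E) => hasFDerivAt_superposition X hdiff D (fun _ => rfl) u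
    have hgoal : ContDiff ℝ ((n : ℕ∞ω) + 1) (fun w : C(K, E) => X.comp w) := by
      refine contDiff_succ_iff_fderiv.2 ⟨fun u => (hder u).differentiableAt, by simp, ?_⟩
      have heq : fderiv ℝ (fun w : C(K, E) => X.comp w)
          = fun u => pointwiseApply K E F (D.comp u) := funext fun u => (hder u).fderiv
      rw [heq]
      exact (pointwiseApply K E F).contDiff.comp (ih D hfd)
    exact_mod_cast hgoal

lemma contDiff_superposition (X : C(E, F)) (hX : ContDiff ℝ ∞ X) :
    ContDiff ℝ ∞ (fun w : C(K, E) => X.comp w) :=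
  contDiff_infty.2 fun n => contDiff_nat_superposition n X (contDiff_infty.1 hX n)

end Superposition

/-! ### The smooth inverse function theorem on an open set -/

section InverseFunction

variable {E F : Type*} [NormedAddCommGroup E] [NormedSpace ℝ E] [NormedAddCommGroup F]
  [NormedSpace ℝ F]

/-- The inverse function theorem in the smooth category: the local inverse is smooth on a whole
neighbourhood, since invertibility of the derivative is an open condition. -/
lemma exists_smooth_openPartialHomeomorph [CompleteSpace E] {f : E → F} {U : Set E}
    (hU : IsOpen U) (hf : ContDiffOn ℝ ∞ f U) {a : E} (ha : a ∈ U) (f' : E ≃L[ℝ] F)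
    (hf' : HasFDerivAt f (f' : E →L[ℝ] F) a) :
    ∃ e : OpenPartialHomeomorph E F, a ∈ e.source ∧ e.source ⊆ U ∧ ⇑e = f ∧
      ContDiffOn ℝ ∞ e e.source ∧ ContDiffOn ℝ ∞ e.symm e.target := by
  have hfa : ContDiffAt ℝ ∞ f a := hf.contDiffAt (hU.mem_nhds ha)
  let e₀ := ContDiffAt.toOpenPartialHomeomorph f hfa hf' (by simp)
  have he₀ : ⇑e₀ = f := ContDiffAt.toOpenPartialHomeomorph_coe hfa hf' (by simp)
  let R : Set (E →L[ℝ] F) :=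
    Set.range (ContinuousLinearEquiv.toContinuousLinearMap : (E ≃L[ℝ] F) → (E →L[ℝ] F))
  have hR : IsOpen R := ContinuousLinearEquiv.isOpen
  have hcont : ContinuousOn (fderiv ℝ f) U := hf.continuousOn_fderiv_of_isOpen hU (by simp)
  let S : Set E := U ∩ fderiv ℝ f ⁻¹' R
  have hS : IsOpen S := hcont.isOpen_inter_preimage hU hR
  let e := e₀.restrOpen S hS
  have he : ⇑e = f := he₀
  have hsrc : e.source = e₀.source ∩ S := rfl
  refine ⟨e, ?_, ?_, he, ?_, ?_⟩
  · rw [hsrc]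
    exact ⟨ContDiffAt.mem_toOpenPartialHomeomorph_source hfa hf' (by simp), ha, f', hf'.fderiv.symm⟩
  · rw [hsrc]; exact fun x hx => hx.2.1
  · rw [he, hsrc]; exact hf.mono fun x hx => hx.2.1
  · intro y hy
    have hx := e.map_target hy
    rw [hsrc] at hx
    obtain ⟨g, hg⟩ := hx.2.2
    have hC : ContDiffAt ℝ ∞ f (e.symm y) := hf.contDiffAt (hU.mem_nhds hx.2.1)
    refine (e.contDiffAt_symm (f₀' := g) hy ?_ ?_).contDiffWithinAt
    · rw [he, hg]; exact (hC.differentiableAt (by simp)).hasFDerivAt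
    · rw [he]; exact hC

end InverseFunction

/-! ### Smooth local flows -/

section Flow

variable {E : Type u} [NormedAddCommGroup E] [NormedSpace ℝ E]

open intervalIntegral

/-- The integration operator `u ↦ (s ↦ ∫₀ˢ u)` on `C([0,1], E)`. -/
noncomputable def primitiveCLM (E : Type u) [NormedAddCommGroup E] [NormedSpace ℝ E] :
    C(unitInterval, E) →L[ℝ] C(unitInterval, E) :=
  have hint : ∀ (u : C(unitInterval, E)) (a b : ℝ),
      IntervalIntegrable (Set.IccExtend zero_le_one u) MeasureTheory.volume a b :=
    fun u a b => (u.continuous.Icc_extend').intervalIntegrable a b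
  LinearMap.mkContinuous
    { toFun := fun u => ⟨fun s => ∫ τ in (0 : ℝ)..s, Set.IccExtend zero_le_one u τ,
        (continuous_primitive (hint u) 0).comp continuous_subtype_val⟩
      map_add' := fun u w => by
        ext s
        exact integral_add (hint u 0 s) (hint w 0 s)
      map_smul' := fun c u => by
        ext s
        exact integral_smul c _ }
    1 (fun u => by
      refine (ContinuousMap.norm_le _ (by positivity)).2 fun s => ?_
      refine (norm_integral_le_of_norm_le_const (C := ‖u‖)
        fun τ _ => u.norm_coe_le_norm _).trans ?_
      rw [sub_zero, abs_of_nonneg s.2.1, one_mul]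
      exact mul_le_of_le_one_right (norm_nonneg _) s.2.2)

lemma primitiveCLM_apply (u : C(unitInterval, E)) (s : unitInterval) :
    primitiveCLM E u s = ∫ τ in (0 : ℝ)..s, Set.IccExtend zero_le_one u τ := rfl

lemma primitiveCLM_rescale (u : C(unitInterval, E)) (s σ : unitInterval) :
    (s : ℝ) • primitiveCLM E (u.comp ⟨fun τ => s * τ, by fun_prop⟩) σ
      = primitiveCLM E u (s * σ) := by
  rw [primitiveCLM_apply, primitiveCLM_apply]
  have h1 : ∫ τ in (0 : ℝ)..σ, Set.IccExtend zero_le_one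
        (u.comp ⟨fun τ => s * τ, by fun_prop⟩ : C(unitInterval, E)) τ
      = ∫ τ in (0 : ℝ)..σ, Set.IccExtend zero_le_one u (s * τ) := by
    refine integral_congr fun τ hτ => ?_
    rw [Set.uIcc_of_le σ.2.1] at hτ
    have hτ' : τ ∈ Set.Icc (0 : ℝ) 1 := ⟨hτ.1, hτ.2.trans σ.2.2⟩
    have hsτ : (s : ℝ) * τ ∈ Set.Icc (0 : ℝ) 1 := unitInterval.mul_mem s.2 hτ'
    simp only [Set.IccExtend_of_mem _ _ hτ', Set.IccExtend_of_mem _ _ hsτ]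
    rfl
  rw [h1, smul_integral_comp_mul_left (Set.IccExtend zero_le_one u) (s : ℝ)]
  simp

/-- A smooth vector field has a smooth local flow `φ`. The curve `s ↦ φ (s t, y)` is found as the
solution `u ∈ C([0,1], E)` of `u = y + t ∫ X(u)`, which depends smoothly on `(t, y)` by the inverse
function theorem in the Banach space `(ℝ × E) × C([0,1], E)`. -/
theorem exists_smooth_flow [CompleteSpace E] {X : E → E} (hX : ContDiff ℝ ∞ X) :
    ∃ (φ : ℝ × E → E) (τ : ℝ), 0 < τ ∧ ContDiffOn ℝ ∞ φ (Metric.ball 0 τ) ∧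
      (∀ y, (0, y) ∈ Metric.ball (0 : ℝ × E) τ → φ (0, y) = y) ∧
      ∀ a ∈ Metric.ball (0 : ℝ × E) τ, fderiv ℝ φ a (1, 0) = X (φ a) := by
  let XC : C(E, E) := ⟨X, hX.continuous⟩
  let Y := C(unitInterval, E)
  let cst : E →L[ℝ] Y := ContinuousLinearMap.const ℝ unitInterval
  let G : (ℝ × E) × Y → Y := fun z => z.2 - cst z.1.2 - z.1.1 • primitiveCLM E (XC.comp z.2)
  let H : (ℝ × E) × Y → (ℝ × E) × Y := fun z => (z.1, G z)
  have hN : ContDiff ℝ ∞ (fun w : Y => XC.comp w) := contDiff_superposition XC hX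
  have hIN : ContDiff ℝ ∞ (fun z : (ℝ × E) × Y => primitiveCLM E (XC.comp z.2)) :=
    (primitiveCLM E).contDiff.comp (hN.comp contDiff_snd)
  have hG : ContDiff ℝ ∞ G :=
    (contDiff_snd.sub (cst.contDiff.comp (contDiff_snd.comp contDiff_fst))).sub
      ((contDiff_fst.comp contDiff_fst).smul hIN)
  have hH : ContDiff ℝ ∞ H := contDiff_fst.prodMk hG
  -- the derivative of `H` at the origin is triangular
  let c₀ : Y := primitiveCLM E (XC.comp 0)
  let A : (ℝ × E) →L[ℝ] Y :=
    -(cst.comp (ContinuousLinearMap.snd ℝ ℝ E)) -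
      (ContinuousLinearMap.fst ℝ ℝ E).smulRight c₀
  let H' : ((ℝ × E) × Y) ≃L[ℝ] ((ℝ × E) × Y) :=
    (ContinuousLinearEquiv.refl ℝ (ℝ × E)).skewProd (ContinuousLinearEquiv.refl ℝ Y) A
  have hH' : HasFDerivAt H (H' : ((ℝ × E) × Y) →L[ℝ] ((ℝ × E) × Y)) 0 := by
    have h1 : HasFDerivAt (fun z : (ℝ × E) × Y => z.1.1 • primitiveCLM E (XC.comp z.2)) _ 0 :=
      ((hasFDerivAt_fst (𝕜 := ℝ) (p := (0 : (ℝ × E) × Y))).fst).smul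
        ((hIN.differentiable (by simp)) 0).hasFDerivAt
    have h2 := ((hasFDerivAt_snd (𝕜 := ℝ) (p := (0 : (ℝ × E) × Y))).sub
      (cst.hasFDerivAt.comp 0 ((hasFDerivAt_fst (𝕜 := ℝ) (p := (0 : (ℝ × E) × Y))).snd))).sub h1
    have h3 := (hasFDerivAt_fst (𝕜 := ℝ) (p := (0 : (ℝ × E) × Y))).prodMk h2
    refine h3.congr_fderiv ?_
    refine ContinuousLinearMap.ext fun z => Prod.ext rfl ?_
    change z.2 - cst z.1.2 - ((0 : ℝ) • _ + z.1.1 • c₀) = z.2 + (-(cst z.1.2) - z.1.1 • c₀)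
    rw [zero_smul, zero_add]
    abel
  obtain ⟨e, h0e, -, he, -, hsymm⟩ :=
    exists_smooth_openPartialHomeomorph isOpen_univ hH.contDiffOn (Set.mem_univ 0) H' hH'
  obtain ⟨δ, hδ, hδs⟩ := Metric.isOpen_iff.1 e.open_source 0 h0e
  have hH0 : e 0 = 0 := by
    rw [he]
    refine Prod.ext rfl ?_
    change (0 : Y) - cst 0 - (0 : ℝ) • _ = 0
    simp
  have h0t : (0 : (ℝ × E) × Y) ∈ e.target := by
    have := e.map_source h0e
    rwa [hH0] at this
  have hs0 : e.symm 0 = 0 := by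
    have := e.left_inv h0e
    rwa [hH0] at this
  let ι : ℝ × E → (ℝ × E) × Y := fun a => (a, 0)
  have hι : ContDiff ℝ ∞ ι := contDiff_id.prodMk contDiff_const
  have hnear : ∀ᶠ a in 𝓝 (0 : ℝ × E), ι a ∈ e.target ∧ e.symm (ι a) ∈ Metric.ball 0 δ := by
    have h1 : ContinuousAt e.symm (ι 0) := e.symm.continuousAt (x := ι 0) h0t
    refine (hι.continuous.continuousAt.eventually (e.open_target.mem_nhds h0t)).and ?_
    refine (h1.comp hι.continuous.continuousAt).eventually (Metric.isOpen_ball.mem_nhds ?_)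
    change e.symm 0 ∈ _
    rw [hs0]; exact Metric.mem_ball_self hδ
  obtain ⟨τ, hτ, hτs⟩ := Metric.eventually_nhds_iff_ball.1
    (hnear.and (Metric.ball_mem_nhds (0 : ℝ × E) hδ))
  let u : ℝ × E → Y := fun a => (e.symm (ι a)).2
  let φ : ℝ × E → E := fun a => u a 1
  have hu : ContDiffOn ℝ ∞ u (Metric.ball 0 τ) :=
    contDiff_snd.comp_contDiffOn (hsymm.comp hι.contDiffOn fun a ha => (hτs a ha).1.1)
  have hφ : ContDiffOn ℝ ∞ φ (Metric.ball 0 τ) :=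
    (ContinuousMap.evalCLM ℝ (M := E) (1 : unitInterval)).contDiff.comp_contDiffOn hu
  -- `u a` solves the integral equation
  have hsol : ∀ a ∈ Metric.ball (0 : ℝ × E) τ,
      e.symm (ι a) = (a, u a) ∧ u a = cst a.2 + a.1 • primitiveCLM E (XC.comp (u a)) := by
    intro a ha
    have h1 := e.right_inv (hτs a ha).1.1
    rw [he] at h1
    have h2 : (e.symm (ι a)).1 = a := congrArg Prod.fst h1
    have h3 : G (e.symm (ι a)) = 0 := congrArg Prod.snd h1
    have h4 : e.symm (ι a) = (a, u a) := Prod.ext h2 rfl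
    rw [h4] at h3
    refine ⟨h4, ?_⟩
    have h5 : u a - cst a.2 - a.1 • primitiveCLM E (XC.comp (u a)) = 0 := h3
    rw [sub_sub, sub_eq_zero] at h5
    exact h5
  -- rescaling time in a solution gives a solution, and solutions near the origin are unique
  have hscale : ∀ a ∈ Metric.ball (0 : ℝ × E) τ, ∀ s : unitInterval,
      φ (a.1 * s, a.2) = u a s := by
    intro a ha s
    have hnorm : ∀ b : ℝ × E, b ∈ Metric.ball (0 : ℝ × E) τ ↔ |b.1| < τ ∧ ‖b.2‖ < τ := by
      intro b; rw [mem_ball_zero_iff, Prod.norm_def, max_lt_iff, Real.norm_eq_abs]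
    have hb : (a.1 * (s : ℝ), a.2) ∈ Metric.ball (0 : ℝ × E) τ := by
      rw [hnorm] at ha ⊢
      refine ⟨lt_of_le_of_lt ?_ ha.1, ha.2⟩
      rw [abs_mul, abs_of_nonneg s.2.1]
      exact mul_le_of_le_one_right (abs_nonneg _) s.2.2
    set b : ℝ × E := (a.1 * (s : ℝ), a.2) with hbdef
    let v : Y := (u a).comp ⟨fun τ => s * τ, by fun_prop⟩
    have hv : ‖v‖ < δ := by
      have h1 := (hτs a ha).1.2
      rw [(hsol a ha).1, mem_ball_zero_iff, Prod.norm_def, max_lt_iff] at h1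
      refine lt_of_le_of_lt ?_ h1.2
      exact (ContinuousMap.norm_le _ (norm_nonneg _)).2 fun σ => (u a).norm_coe_le_norm _
    have hbv : (b, v) ∈ e.source := by
      apply hδs
      rw [mem_ball_zero_iff, Prod.norm_def, max_lt_iff]
      exact ⟨mem_ball_zero_iff.1 (hτs b hb).2, hv⟩
    have hHv : e (b, v) = ι b := by
      rw [he]
      refine Prod.ext rfl ?_
      ext σ
      have h1 : u a (s * σ) = a.2 + a.1 • primitiveCLM E (XC.comp (u a)) (s * σ) :=
        congrArg (fun w : Y => w (s * σ)) (hsol a ha).2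
      have h2 := primitiveCLM_rescale (XC.comp (u a)) s σ
      change u a (s * σ) - a.2 - (a.1 * (s : ℝ)) • primitiveCLM E (XC.comp v) σ = 0
      rw [h1, mul_smul, ← h2]
      change a.2 + _ - a.2 - a.1 • (s : ℝ) • primitiveCLM E
        ((XC.comp (u a)).comp ⟨fun τ => s * τ, by fun_prop⟩) σ = 0
      abel
    have h3 : e.symm (ι b) = (b, v) := by rw [← hHv]; exact e.left_inv hbv
    have h4 : u b = v := congrArg Prod.snd h3
    change u b 1 = u a s
    rw [h4]
    change u a (s * 1) = u a s
    rw [mul_one]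
  have hφdiff : ∀ a ∈ Metric.ball (0 : ℝ × E) τ, DifferentiableAt ℝ φ a := fun a ha =>
    (hφ.contDiffAt (Metric.isOpen_ball.mem_nhds ha)).differentiableAt (by simp)
  -- the differential equation at times `t ≠ 0`
  have hode : ∀ a ∈ Metric.ball (0 : ℝ × E) (τ / 2), a.1 ≠ 0 →
      fderiv ℝ φ a (1, 0) = X (φ a) := by
    intro a ha hne
    have ha' : ((2 * a.1, a.2) : ℝ × E) ∈ Metric.ball (0 : ℝ × E) τ := by
      rw [mem_ball_zero_iff, Prod.norm_def, max_lt_iff, Real.norm_eq_abs] at ha ⊢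
      refine ⟨?_, by linarith [ha.2]⟩
      rw [abs_mul, abs_two]; linarith [ha.1]
    have haτ : a ∈ Metric.ball (0 : ℝ × E) τ := Metric.ball_subset_ball (by linarith) ha
    set b : ℝ × E := (2 * a.1, a.2) with hbdef
    let γ : ℝ → E := fun s => a.2 + (2 * a.1) •
      ∫ σ in (0 : ℝ)..s, Set.IccExtend zero_le_one (XC.comp (u b)) σ
    have hγ : HasDerivAt γ
        ((2 * a.1) • Set.IccExtend zero_le_one (XC.comp (u b)) (1 / 2)) (1 / 2) :=
      ((((XC.comp (u b)).continuous.Icc_extend').integral_hasStrictDerivAt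
        0 (1 / 2)).hasDerivAt.const_smul _).const_add _
    have hγφ : γ =ᶠ[𝓝 (1 / 2)] fun s => φ (2 * a.1 * s, a.2) := by
      filter_upwards [Icc_mem_nhds (show (0 : ℝ) < 1 / 2 by norm_num)
        (show (1 / 2 : ℝ) < 1 by norm_num)] with s hs
      have h1 := hscale b ha' ⟨s, hs⟩
      change φ (2 * a.1 * s, a.2) = _ at h1
      rw [h1, (hsol b ha').2]
      rfl
    have hhalf : (2 * a.1 * (1 / 2), a.2) = a := by
      refine Prod.ext ?_ rfl
      change 2 * a.1 * (1 / 2) = a.1; ring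
    have hline : HasDerivAt (fun s : ℝ => ((2 * a.1 * s, a.2) : ℝ × E)) (2 * a.1, 0) (1 / 2) := by
      have h1 : HasDerivAt (fun s : ℝ => 2 * a.1 * s) (2 * a.1) (1 / 2) := by
        simpa using (hasDerivAt_id (1 / 2 : ℝ)).const_mul (2 * a.1)
      exact h1.prodMk (hasDerivAt_const _ _)
    have hchain : HasDerivAt (fun s => φ (2 * a.1 * s, a.2))
        (fderiv ℝ φ a (2 * a.1, 0)) (1 / 2) := by
      have h1 := (hφdiff a haτ).hasFDerivAt
      rw [← hhalf] at h1
      have h2 := h1.comp_hasDerivAt (1 / 2 : ℝ) hline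
      rwa [hhalf] at h2
    have huniq := hchain.unique (hγ.congr_of_eventuallyEq hγφ.symm)
    have h1 : ((2 * a.1, 0) : ℝ × E) = (2 * a.1) • (1, 0) := by simp
    rw [h1, map_smul] at huniq
    have h2 := smul_right_injective E (mul_ne_zero two_ne_zero hne) huniq
    rw [h2]
    have hmem : (1 / 2 : ℝ) ∈ Set.Icc (0 : ℝ) 1 := by constructor <;> norm_num
    rw [Set.IccExtend_of_mem _ _ hmem]
    change X (u b ⟨1 / 2, hmem⟩) = X (φ a)
    rw [← hscale b ha' ⟨1 / 2, hmem⟩]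
    exact congrArg (fun c => X (φ c)) hhalf
  refine ⟨φ, τ / 2, by positivity,
    hφ.mono (Metric.ball_subset_ball (by linarith)), ?_, ?_⟩
  · intro y hy
    have h1 : u (0, y) = cst y + (0 : ℝ) • _ :=
      (hsol (0, y) (Metric.ball_subset_ball (by linarith) hy)).2
    change u (0, y) 1 = y
    rw [h1, zero_smul, add_zero]
    rfl
  -- both sides of the differential equation are continuous, so `t = 0` follows
  · intro a ha
    have haτ : a ∈ Metric.ball (0 : ℝ × E) τ := Metric.ball_subset_ball (by linarith) ha
    by_cases hne : a.1 = 0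
    · have hline : Filter.Tendsto (fun t : ℝ => ((t, a.2) : ℝ × E)) (𝓝[≠] 0) (𝓝 a) := by
        have h1 : Filter.Tendsto (fun t : ℝ => ((t, a.2) : ℝ × E)) (𝓝 0) (𝓝 (0, a.2)) :=
          (Continuous.prodMk continuous_id continuous_const).continuousAt
        rw [show ((0, a.2) : ℝ × E) = a from Prod.ext hne.symm rfl] at h1
        exact h1.mono_left nhdsWithin_le_nhds
      have hcφ : ContDiffAt ℝ ∞ φ a := hφ.contDiffAt (Metric.isOpen_ball.mem_nhds haτ)
      have h1 : Filter.Tendsto (fun t : ℝ => fderiv ℝ φ (t, a.2) (1, 0)) (𝓝[≠] 0)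
          (𝓝 (fderiv ℝ φ a (1, 0))) :=
        ((hcφ.continuousAt_fderiv (by simp)).clm_apply continuousAt_const).tendsto.comp hline
      have h2 : Filter.Tendsto (fun t : ℝ => X (φ (t, a.2))) (𝓝[≠] 0) (𝓝 (X (φ a))) :=
        ((hX.continuous.continuousAt.comp hcφ.continuousAt).tendsto).comp hline
      refine tendsto_nhds_unique h1 (h2.congr' ?_)
      filter_upwards [hline.eventually (Metric.isOpen_ball.mem_nhds ha), self_mem_nhdsWithin]
        with t ht ht0
      exact (hode _ ht ht0).symm
    · exact hode a ha hne

end Flow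

/-! ### Straightening a vector field -/

section Straightening

variable {E : Type u} [NormedAddCommGroup E] [NormedSpace ℝ E]

/-- A vector field that is smooth near the origin agrees near the origin with a globally smooth
one. -/
lemma exists_contDiff_eqOn_ball [HasContDiffBump E] {X : E → E} {U : Set E} (hU : IsOpen U)
    (h0 : (0 : E) ∈ U) (hX : ContDiffOn ℝ ∞ X U) :
    ∃ (Y : E → E) (r : ℝ), 0 < r ∧ Metric.ball 0 r ⊆ U ∧ ContDiff ℝ ∞ Y ∧
      Set.EqOn Y X (Metric.ball 0 r) := by
  obtain ⟨R, hR, hRU⟩ := Metric.isOpen_iff.1 hU 0 h0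
  let f : ContDiffBump (0 : E) := ⟨R / 4, R / 2, by positivity, by linarith⟩
  refine ⟨fun x => f x • X x, R / 4, by positivity,
    (Metric.ball_subset_ball (by linarith)).trans hRU, ?_, ?_⟩
  · rw [contDiff_iff_contDiffAt]
    intro x
    by_cases hx : x ∈ U
    · exact f.contDiffAt.smul (hX.contDiffAt (hU.mem_nhds hx))
    · have hx' : x ∉ tsupport f := by
        rw [f.tsupport_eq]
        exact fun h => hx (hRU (Metric.closedBall_subset_ball (show R / 2 < R by linarith) h))
      refine (contDiffAt_const (c := (0 : E))).congr_of_eventuallyEq ?_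
      filter_upwards [(isClosed_tsupport f).isOpen_compl.mem_nhds hx'] with y hy
      rw [image_eq_zero_of_notMem_tsupport hy, zero_smul]
  · intro x hx
    change f x • X x = X x
    rw [f.one_of_mem_closedBall (Metric.ball_subset_closedBall hx), one_smul]

/-- A smooth vector field `X` with `X 0 = v ≠ 0` is straightened to the constant field `v` by a
local diffeomorphism `Ψ`, built from the flow of `X` with time `μ`. The directions in the range of
the projection `ρ`, along which `X` is constant, are left alone, and so is every linear functional
that is constant on `X`. -/
theorem exists_straightening [CompleteSpace E] [HasContDiffBump E] {X : E → E} {U : Set E}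
    (hU : IsOpen U) (h0 : (0 : E) ∈ U) (hX : ContDiffOn ℝ ∞ X U) {v : E} (hv : X 0 = v)
    (μ : E →L[ℝ] ℝ) (hμ : μ v = 1) (ρ : E →L[ℝ] E) (hρρ : ∀ x, ρ (ρ x) = ρ x)
    (hμρ : ∀ x, μ (ρ x) = 0) (hρv : ρ v = 0) (hinv : ∀ x ∈ U, ∀ w, fderiv ℝ X x (ρ w) = 0) :
    ∃ Ψ : OpenPartialHomeomorph E E, 0 ∈ Ψ.source ∧ Ψ 0 = 0 ∧ Ψ.target ⊆ U ∧
      ContDiffOn ℝ ∞ Ψ Ψ.source ∧ ContDiffOn ℝ ∞ Ψ.symm Ψ.target ∧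
      (∀ x ∈ Ψ.source, ∀ w, fderiv ℝ Ψ x (ρ w) = ρ w) ∧
      (∀ x ∈ Ψ.source, fderiv ℝ Ψ x v = X (Ψ x)) ∧
      (∀ x ∈ Ψ.source, ∀ ν : E →L[ℝ] ℝ, (∀ y ∈ U, ν (X y) = ν v) → ν (Ψ x) = ν x) := by
  obtain ⟨Y, r, hr, hrU, hY, hYX⟩ := exists_contDiff_eqOn_ball hU h0 hX
  let π : E →L[ℝ] E := ContinuousLinearMap.id ℝ E - ρ
  have hπ : ∀ x, π x = x - ρ x := fun x => rfl
  have hπρ : ∀ x, π (ρ x) = 0 := fun x => by rw [hπ, hρρ, sub_self]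
  -- `Z` is globally smooth, globally constant along the range of `ρ`, and agrees with `X` near `0`
  let Z : E → E := fun x => Y (π x)
  have hZ : ContDiff ℝ ∞ Z := hY.comp π.contDiff
  have hZnear : ∀ᶠ x in 𝓝 (0 : E), Z x = X x := by
    have h1 : ∀ᶠ x in 𝓝 (0 : E), π x ∈ Metric.ball (0 : E) r := by
      refine π.continuous.continuousAt.eventually (Metric.isOpen_ball.mem_nhds ?_)
      rw [map_zero]; exact Metric.mem_ball_self hr
    filter_upwards [h1, Metric.ball_mem_nhds (0 : E) hr] with x hπx hx
    have hseg : ∀ s ∈ Set.Icc (0 : ℝ) 1, π x + s • ρ x ∈ Metric.ball (0 : E) r := by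
      intro s hs
      have h2 : π x + s • ρ x = (1 - s) • π x + s • x := by rw [hπ]; module
      rw [h2]
      exact convex_ball (0 : E) r hπx hx (by linarith [hs.2]) hs.1 (by ring)
    have hder : ∀ s ∈ Set.Icc (0 : ℝ) 1, HasDerivAt (fun s : ℝ => X (π x + s • ρ x)) 0 s := by
      intro s hs
      have hmem := hrU (hseg s hs)
      have hd := ((hX.contDiffAt (hU.mem_nhds hmem)).differentiableAt (by simp)).hasFDerivAt
      have hline : HasDerivAt (fun s : ℝ => π x + s • ρ x) (ρ x) s := by
        simpa using ((hasDerivAt_id s).smul_const (ρ x)).const_add (π x)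
      have := hd.comp_hasDerivAt s hline
      rwa [hinv _ hmem] at this
    have h3 := constant_of_has_deriv_right_zero
      (fun s hs => (hder s hs).continuousAt.continuousWithinAt)
      (fun s hs => (hder s (Set.Ico_subset_Icc_self hs)).hasDerivWithinAt) 1
      (Set.right_mem_Icc.2 zero_le_one)
    simp only [one_smul, zero_smul, add_zero] at h3
    rw [hπ, sub_add_cancel, ← hπ] at h3
    rw [h3]
    exact hYX hπx
  obtain ⟨r₂, hr₂, hZX⟩ := Metric.eventually_nhds_iff_ball.1
    (hZnear.and (Metric.ball_mem_nhds (0 : E) hr))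
  have hr₂U : Metric.ball (0 : E) r₂ ⊆ U := fun x hx => hrU (hZX x hx).2
  obtain ⟨φ, τ₀, hτ₀, hφ₀, hφ0, hode₀⟩ := exists_smooth_flow hZ
  have h00 : ((0 : ℝ × E)) ∈ Metric.ball (0 : ℝ × E) τ₀ := Metric.mem_ball_self hτ₀
  have hφz : φ 0 = 0 := hφ0 0 h00
  have hφnear : ∀ᶠ a in 𝓝 (0 : ℝ × E), φ a ∈ Metric.ball (0 : E) r₂ := by
    refine (hφ₀.continuousOn.continuousAt (Metric.isOpen_ball.mem_nhds h00)).eventually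
      (Metric.isOpen_ball.mem_nhds ?_)
    rw [hφz]; exact Metric.mem_ball_self hr₂
  obtain ⟨τ, hτ, hτs⟩ := Metric.eventually_nhds_iff_ball.1
    (hφnear.and (Metric.ball_mem_nhds (0 : ℝ × E) hτ₀))
  have hsub : Metric.ball (0 : ℝ × E) τ ⊆ Metric.ball 0 τ₀ := fun a ha => (hτs a ha).2
  have hφ : ContDiffOn ℝ ∞ φ (Metric.ball 0 τ) := hφ₀.mono hsub
  have hode : ∀ a ∈ Metric.ball (0 : ℝ × E) τ, fderiv ℝ φ a (1, 0) = Z (φ a) :=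
    fun a ha => hode₀ a (hsub ha)
  have hφdiff : ∀ a ∈ Metric.ball (0 : ℝ × E) τ, HasFDerivAt φ (fderiv ℝ φ a) a := fun a ha =>
    ((hφ.contDiffAt (Metric.isOpen_ball.mem_nhds ha)).differentiableAt (by simp)).hasFDerivAt
  let L : E →L[ℝ] ℝ × E := μ.prod (π - μ.smulRight v)
  have hL : ∀ x, L x = (μ x, π x - μ x • v) := fun x => rfl
  -- `Ψ₀ x` flows for the time `μ x`, starting on the hyperplane `μ = 0`; the component in the range
  -- of `ρ` is left out of the flow and added afterwards, so that it is preserved exactly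
  let Ψ₀ : E → E := fun x => ρ x + φ (L x)
  let V : Set E := L ⁻¹' Metric.ball 0 τ
  have hV : IsOpen V := Metric.isOpen_ball.preimage L.continuous
  have h0V : (0 : E) ∈ V := by
    change L 0 ∈ Metric.ball 0 τ
    rw [map_zero]; exact Metric.mem_ball_self hτ
  have hΨV : ContDiffOn ℝ ∞ Ψ₀ V :=
    ρ.contDiff.contDiffOn.add (hφ.comp L.contDiff.contDiffOn fun x hx => hx)
  let W : Set E := V ∩ Ψ₀ ⁻¹' Metric.ball 0 r₂
  have hW : IsOpen W := hΨV.continuousOn.isOpen_inter_preimage hV Metric.isOpen_ball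
  have hΨ0 : Ψ₀ 0 = 0 := by
    change ρ 0 + φ (L 0) = 0
    rw [map_zero, map_zero, hφz, add_zero]
  have h0W : (0 : E) ∈ W := by
    refine ⟨h0V, ?_⟩
    change Ψ₀ 0 ∈ Metric.ball 0 r₂
    rw [hΨ0]; exact Metric.mem_ball_self hr₂
  have hΨder : ∀ x ∈ V, HasFDerivAt Ψ₀ (ρ + (fderiv ℝ φ (L x)).comp L) x := fun x hx =>
    ρ.hasFDerivAt.add ((hφdiff (L x) hx).comp x L.hasFDerivAt)
  have hid : HasFDerivAt Ψ₀ ((ContinuousLinearEquiv.refl ℝ E : E ≃L[ℝ] E) : E →L[ℝ] E) 0 := by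
    refine (hΨder 0 h0V).congr_fderiv (ContinuousLinearMap.ext fun w => ?_)
    have h0τ : (0 : ℝ × E) ∈ Metric.ball (0 : ℝ × E) τ := Metric.mem_ball_self hτ
    have htime : fderiv ℝ φ 0 (1, 0) = v := by
      rw [hode 0 h0τ, hφz, (hZX 0 (Metric.mem_ball_self hr₂)).1, hv]
    have hspace : ∀ y : E, fderiv ℝ φ 0 (0, y) = y := by
      intro y
      have h1 : HasFDerivAt (fun y : E => φ (0, y))
          ((fderiv ℝ φ 0).comp (ContinuousLinearMap.inr ℝ ℝ E)) 0 :=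
        (hφdiff 0 h0τ).comp (0 : E) (ContinuousLinearMap.inr ℝ ℝ E).hasFDerivAt
      have h2 : (fun y : E => φ (0, y)) =ᶠ[𝓝 0] id := by
        have h3 : ∀ᶠ y in 𝓝 (0 : E), ((0, y) : ℝ × E) ∈ Metric.ball (0 : ℝ × E) τ₀ :=
          (Continuous.prodMk_right (0 : ℝ)).continuousAt.eventually
            (Metric.isOpen_ball.mem_nhds h00)
        filter_upwards [h3] with y hy using hφ0 y hy
      exact congrArg (fun A : E →L[ℝ] E => A y)
        (h1.unique ((hasFDerivAt_id (0 : E)).congr_of_eventuallyEq h2))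
    have hsplit : L w = μ w • ((1, 0) : ℝ × E) + (0, π w - μ w • v) := by simp [hL]
    change ρ w + fderiv ℝ φ (L 0) (L w) = w
    rw [map_zero L, hsplit, map_add, map_smul, htime, hspace, hπ]
    abel
  obtain ⟨e, h0e, heW, he, hse, hse'⟩ :=
    exists_smooth_openPartialHomeomorph hW (hΨV.mono Set.inter_subset_left) h0W _ hid
  have hfd : ∀ x ∈ e.source, ∀ w, fderiv ℝ e x w = ρ w + fderiv ℝ φ (L x) (L w) := by
    intro x hx w
    rw [he, (hΨder x (heW hx).1).fderiv]
    rfl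
  have hπΨ : ∀ x, π (Ψ₀ x) = π (φ (L x)) := fun x => by
    change π (ρ x + φ (L x)) = _
    rw [map_add, hπρ, zero_add]
  refine ⟨e, h0e, by rw [he, hΨ0], ?_, hse, hse', ?_, ?_, ?_⟩
  · intro y hy
    have h1 := heW (e.map_target hy)
    have h2 : Ψ₀ (e.symm y) = y := by rw [← he]; exact e.right_inv hy
    have h3 : Ψ₀ (e.symm y) ∈ Metric.ball (0 : E) r₂ := h1.2
    rw [h2] at h3
    exact hr₂U h3
  · intro x hx w
    have h1 : L (ρ w) = 0 := by rw [hL, hμρ, hπρ, zero_smul, sub_zero]; rfl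
    rw [hfd x hx, h1, map_zero, hρρ, add_zero]
  · intro x hx
    have h1 : L v = (1, 0) := by rw [hL, hμ, hπ, hρv, one_smul, sub_zero, sub_self]
    rw [hfd x hx, h1, hρv, zero_add, hode (L x) (heW hx).1, he, ← (hZX _ (heW hx).2).1]
    change Y (π (φ (L x))) = Y (π (Ψ₀ x))
    rw [hπΨ]
  · intro x hx ν hν
    have hLx : L x ∈ Metric.ball (0 : ℝ × E) τ := (heW hx).1
    set y : E := π x - μ x • v with hy
    have hmem : ∀ s ∈ Set.Icc (0 : ℝ) 1, ((s * μ x, y) : ℝ × E) ∈ Metric.ball (0 : ℝ × E) τ := by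
      intro s hs
      rw [hL, mem_ball_zero_iff, Prod.norm_def, max_lt_iff, Real.norm_eq_abs] at hLx
      rw [mem_ball_zero_iff, Prod.norm_def, max_lt_iff, Real.norm_eq_abs]
      refine ⟨lt_of_le_of_lt ?_ hLx.1, hLx.2⟩
      rw [abs_mul, abs_of_nonneg hs.1]
      exact mul_le_of_le_one_left (abs_nonneg _) hs.2
    have hder : ∀ s ∈ Set.Icc (0 : ℝ) 1,
        HasDerivAt (fun s : ℝ => ν (φ (s * μ x, y)) - s * (μ x * ν v)) 0 s := by
      intro s hs
      have hline : HasDerivAt (fun s : ℝ => ((s * μ x, y) : ℝ × E)) (μ x, 0) s := by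
        have h1 : HasDerivAt (fun s : ℝ => s * μ x) (μ x) s := by
          simpa using (hasDerivAt_id s).mul_const (μ x)
        exact h1.prodMk (hasDerivAt_const _ _)
      have h1 := ν.hasFDerivAt.comp_hasDerivAt s ((hφdiff _ (hmem s hs)).comp_hasDerivAt s hline)
      have h2 : HasDerivAt (fun s : ℝ => s * (μ x * ν v)) (μ x * ν v) s := by
        simpa using (hasDerivAt_id s).mul_const (μ x * ν v)
      refine (h1.sub h2).congr_deriv ?_
      have h3 : ((μ x, 0) : ℝ × E) = μ x • (1, 0) := by simp
      have hb := (hτs _ (hmem s hs)).1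
      rw [h3, map_smul, hode _ (hmem s hs), (hZX _ hb).1, map_smul, hν _ (hr₂U hb),
        smul_eq_mul, sub_self]
    have h3 := constant_of_has_deriv_right_zero
      (fun s hs => (hder s hs).continuousAt.continuousWithinAt)
      (fun s hs => (hder s (Set.Ico_subset_Icc_self hs)).hasDerivWithinAt) 1
      (Set.right_mem_Icc.2 zero_le_one)
    simp only [one_mul, zero_mul, sub_zero] at h3
    have h4 := hmem 0 (Set.left_mem_Icc.2 zero_le_one)
    rw [zero_mul] at h4
    rw [hφ0 y (hsub h4)] at h3
    rw [he]
    change ν (ρ x + φ (μ x, y)) = ν x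
    rw [map_add, sub_eq_iff_eq_add.1 h3, hy, map_sub, map_smul, hπ, map_sub, smul_eq_mul]
    ring

end Straightening

/-! ### Poisson bivectors without coordinates -/

section Bivector

variable {E F G : Type u} [NormedAddCommGroup E] [NormedSpace ℝ E]
  [NormedAddCommGroup F] [NormedSpace ℝ F] [NormedAddCommGroup G] [NormedSpace ℝ G]

/-- The Poisson bracket `{f, g} = df(P dg)`. A bivector field is encoded as the field `P` of maps
`E* → E` that contract its second slot with a covector. -/
noncomputable def bracket (P : E → (E →L[ℝ] ℝ) →L[ℝ] E) (f g : E → ℝ) (x : E) : ℝ :=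
  fderiv ℝ f x (P x (fderiv ℝ g x))

/-- `P` is a smooth Poisson bivector on `U`. The Jacobi identity is imposed on all functions that
are twice differentiable at the point in question, which makes it invariant under changes of
coordinates. -/
structure IsPoissonBivector (P : E → (E →L[ℝ] ℝ) →L[ℝ] E) (U : Set E) : Prop where
  smooth : ContDiffOn ℝ ∞ P U
  antisymm : ∀ x ∈ U, ∀ α β : E →L[ℝ] ℝ, α (P x β) = -β (P x α)
  jacobi : ∀ x ∈ U, ∀ f g h : E → ℝ, ContDiffAt ℝ 2 f x → ContDiffAt ℝ 2 g x →
    ContDiffAt ℝ 2 h x → bracket P f (bracket P g h) x + bracket P g (bracket P h f) x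
      + bracket P h (bracket P f g) x = 0

lemma IsPoissonBivector.mono {P : E → (E →L[ℝ] ℝ) →L[ℝ] E} {U V : Set E}
    (h : IsPoissonBivector P U) (hVU : V ⊆ U) : IsPoissonBivector P V :=
  ⟨h.smooth.mono hVU, fun x hx => h.antisymm x (hVU hx), fun x hx => h.jacobi x (hVU hx)⟩

lemma bracket_differentiableAt {P : E → (E →L[ℝ] ℝ) →L[ℝ] E} {x : E} (hP : ContDiffAt ℝ ∞ P x)
    {f g : E → ℝ} (hf : ContDiffAt ℝ 2 f x) (hg : ContDiffAt ℝ 2 g x) :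
    DifferentiableAt ℝ (bracket P f g) x := by
  have h1 : ∀ {f : E → ℝ}, ContDiffAt ℝ 2 f x → DifferentiableAt ℝ (fderiv ℝ f) x := fun hf =>
    (hf.fderiv_right (m := 1) (by norm_num)).differentiableAt (by simp)
  exact (h1 hf).clm_apply ((hP.differentiableAt (by simp)).clm_apply (h1 hg))

/-- The Jacobi identity for constant covectors implies the Jacobi identity for functions: the
second derivatives cancel by their symmetry. -/
lemma jacobi_of_const {P : E → (E →L[ℝ] ℝ) →L[ℝ] E} {x : E} (hP : ContDiffAt ℝ ∞ P x)
    (hanti : ∀ α β : E →L[ℝ] ℝ, α (P x β) = -β (P x α))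
    (hjac : ∀ α β γ : E →L[ℝ] ℝ, β (fderiv ℝ P x (P x α) γ) + γ (fderiv ℝ P x (P x β) α)
      + α (fderiv ℝ P x (P x γ) β) = 0)
    {f g h : E → ℝ} (hf : ContDiffAt ℝ 2 f x) (hg : ContDiffAt ℝ 2 g x)
    (hh : ContDiffAt ℝ 2 h x) :
    bracket P f (bracket P g h) x + bracket P g (bracket P h f) x
      + bracket P h (bracket P f g) x = 0 := by
  have hd : ∀ {f : E → ℝ}, ContDiffAt ℝ 2 f x →
      HasFDerivAt (fderiv ℝ f) (fderiv ℝ (fderiv ℝ f) x) x := fun hf =>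
    ((hf.fderiv_right (m := 1) (by norm_num)).differentiableAt (by simp)).hasFDerivAt
  have hsym : ∀ {f : E → ℝ}, ContDiffAt ℝ 2 f x → ∀ v w,
      fderiv ℝ (fderiv ℝ f) x v w = fderiv ℝ (fderiv ℝ f) x w v := fun hf v w =>
    (hf.isSymmSndFDerivAt (by simp)).eq v w
  have hPd := (hP.differentiableAt (by simp)).hasFDerivAt
  have key : ∀ {f g h : E → ℝ}, ContDiffAt ℝ 2 f x → ContDiffAt ℝ 2 g x → ContDiffAt ℝ 2 h x →
      bracket P f (bracket P g h) x =
        -(fderiv ℝ g x (fderiv ℝ P x (P x (fderiv ℝ f x)) (fderiv ℝ h x)))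
        + fderiv ℝ (fderiv ℝ h) x (P x (fderiv ℝ f x)) (P x (fderiv ℝ g x))
        - fderiv ℝ (fderiv ℝ g) x (P x (fderiv ℝ f x)) (P x (fderiv ℝ h x)) := by
    intro f g h hf hg hh
    have h1 : HasFDerivAt (bracket P g h) _ x := (hd hg).clm_apply (hPd.clm_apply (hd hh))
    change fderiv ℝ f x (P x (fderiv ℝ (bracket P g h) x)) = _
    rw [hanti, h1.fderiv]
    simp only [add_apply, ContinuousLinearMap.comp_apply,
      ContinuousLinearMap.flip_apply, map_add]
    rw [hanti (fderiv ℝ g x)]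
    ring
  rw [key hf hg hh, key hg hh hf, key hh hf hg, hsym hf (P x (fderiv ℝ h x)),
    hsym hg (P x (fderiv ℝ f x)), hsym hh (P x (fderiv ℝ g x))]
  have := hjac (fderiv ℝ f x) (fderiv ℝ g x) (fderiv ℝ h x)
  linarith

/-- If `P α` is the constant vector `w`, then every Hamiltonian field `P γ` of a linear functional
is constant in the direction `w`: for linear `β` the brackets `{γ, α}` and `{α, β}` are constant, so
the Jacobi identity reduces to `{α, {β, γ}} = 0`. -/
lemma IsPoissonBivector.fderiv_hamiltonian_eq_zero {P : E → (E →L[ℝ] ℝ) →L[ℝ] E} {U : Set E}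
    (hP : IsPoissonBivector P U) (hU : IsOpen U) {α : E →L[ℝ] ℝ} {w : E}
    (hα : ∀ x ∈ U, P x α = w) (γ : E →L[ℝ] ℝ) {x : E} (hx : x ∈ U) :
    fderiv ℝ (fun y => P y γ) x w = 0 := by
  have hPd : DifferentiableAt ℝ P x :=
    (hP.smooth.contDiffAt (hU.mem_nhds hx)).differentiableAt (by simp)
  have hder : HasFDerivAt (fun y => P y γ) ((fderiv ℝ P x).flip γ) x := by
    simpa using hPd.hasFDerivAt.clm_apply (hasFDerivAt_const γ x)
  refine (SeparatingDual.eq_zero_iff_forall_dual_eq_zero (R := ℝ) _).2 fun β => ?_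
  have hlin : ∀ δ : E →L[ℝ] ℝ, ContDiffAt ℝ 2 δ x := fun δ => δ.contDiff.contDiffAt
  have hj := hP.jacobi x hx α β γ (hlin α) (hlin β) (hlin γ)
  have hbr : ∀ (δ ε : E →L[ℝ] ℝ), bracket P δ ε = fun y => δ (P y ε) := by
    intro δ ε
    funext y
    simp [bracket]
  have hconst : ∀ δ ε : E →L[ℝ] ℝ, (∃ c : ℝ, ∀ y ∈ U, δ (P y ε) = c) →
      ∀ η : E →L[ℝ] ℝ, bracket P η (bracket P δ ε) x = 0 := by
    rintro δ ε ⟨c, hc⟩ η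
    have h1 : bracket P δ ε =ᶠ[𝓝 x] fun _ => c := by
      rw [hbr]
      filter_upwards [hU.mem_nhds hx] with y hy using hc y hy
    have h2 : fderiv ℝ (bracket P δ ε) x = 0 := by
      rw [h1.fderiv_eq]; simp
    change fderiv ℝ η x (P x (fderiv ℝ (bracket P δ ε) x)) = 0
    rw [h2, map_zero, map_zero]
  rw [hconst γ α ⟨γ w, fun y hy => by rw [hα y hy]⟩,
    hconst α β ⟨-β w, fun y hy => by rw [hP.antisymm y hy, hα y hy]⟩, add_zero, add_zero] at hj
  have h3 : HasFDerivAt (bracket P β γ) (β.comp ((fderiv ℝ P x).flip γ)) x := by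
    rw [hbr]; exact β.hasFDerivAt.comp x hder
  change fderiv ℝ α x (P x (fderiv ℝ (bracket P β γ) x)) = 0 at hj
  rw [h3.fderiv, ContinuousLinearMap.fderiv, hP.antisymm x hx, hα x hx, neg_eq_zero] at hj
  rw [hder.fderiv]
  exact hj

/-! ### Change of coordinates -/

/-- `z` is a smooth chart: it is smooth, and so is its inverse. -/
structure IsSmoothChart (z : OpenPartialHomeomorph E F) : Prop where
  smooth : ContDiffOn ℝ ∞ z z.source
  smooth_symm : ContDiffOn ℝ ∞ z.symm z.target

namespace IsSmoothChart

variable {z : OpenPartialHomeomorph E F}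

lemma symm (hz : IsSmoothChart z) : IsSmoothChart z.symm := ⟨hz.smooth_symm, hz.smooth⟩

lemma trans (hz : IsSmoothChart z) {w : OpenPartialHomeomorph F G} (hw : IsSmoothChart w) :
    IsSmoothChart (z.trans w) := by
  refine ⟨?_, ?_⟩
  · rw [OpenPartialHomeomorph.trans_source]
    exact hw.smooth.comp (hz.smooth.mono Set.inter_subset_left) fun x hx => hx.2
  · rw [OpenPartialHomeomorph.trans_target]
    exact hz.smooth_symm.comp (hw.smooth_symm.mono Set.inter_subset_left) fun x hx => hx.2

lemma hasFDerivAt (hz : IsSmoothChart z) {x : E} (hx : x ∈ z.source) :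
    HasFDerivAt z (fderiv ℝ z x) x :=
  ((hz.smooth.contDiffAt (z.open_source.mem_nhds hx)).differentiableAt (by simp)).hasFDerivAt

/-- The derivative of the inverse of a chart is a left inverse of the derivative of the chart. -/
lemma fderiv_symm_apply (hz : IsSmoothChart z) {x : E} (hx : x ∈ z.source) (v : E) :
    fderiv ℝ z.symm (z x) (fderiv ℝ z x v) = v := by
  have h1 := (hz.symm.hasFDerivAt (z.map_source hx)).comp x (hz.hasFDerivAt hx)
  have h2 : z.symm ∘ z =ᶠ[𝓝 x] id := by
    filter_upwards [z.open_source.mem_nhds hx] with y hy using z.left_inv hy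
  exact congrArg (fun A : E →L[ℝ] E => A v)
    (h1.unique ((hasFDerivAt_id x).congr_of_eventuallyEq h2))

/-- The derivative of the inverse of a chart is a right inverse of the derivative of the chart. -/
lemma fderiv_apply_symm (hz : IsSmoothChart z) {x : E} (hx : x ∈ z.source) (v : F) :
    fderiv ℝ z x (fderiv ℝ z.symm (z x) v) = v := by
  have := hz.symm.fderiv_symm_apply (z.map_source hx) v
  rwa [z.left_inv hx] at this

end IsSmoothChart

/-- The bivector field `P` transported by the chart `z`: at `z x` it is `Dz ∘ P ∘ (Dz)*`, with
everything on the right taken at `x`. -/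
noncomputable def pushforward (z : OpenPartialHomeomorph E F) (P : E → (E →L[ℝ] ℝ) →L[ℝ] E)
    (y : F) : (F →L[ℝ] ℝ) →L[ℝ] F :=
  (fderiv ℝ z (z.symm y)).comp ((P (z.symm y)).comp
    ((ContinuousLinearMap.compL ℝ E F ℝ).flip (fderiv ℝ z (z.symm y))))

lemma pushforward_apply (z : OpenPartialHomeomorph E F) (P : E → (E →L[ℝ] ℝ) →L[ℝ] E)
    (y : F) (α : F →L[ℝ] ℝ) :
    pushforward z P y α = fderiv ℝ z (z.symm y) (P (z.symm y) (α.comp (fderiv ℝ z (z.symm y)))) :=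
  rfl

lemma pushforward_trans {z : OpenPartialHomeomorph E F} (hz : IsSmoothChart z)
    {w : OpenPartialHomeomorph F G} (hw : IsSmoothChart w) (P : E → (E →L[ℝ] ℝ) →L[ℝ] E)
    {y : G} (hy : y ∈ (z.trans w).target) :
    pushforward (z.trans w) P y = pushforward w (pushforward z P) y := by
  have hx := (z.trans w).map_target hy
  rw [OpenPartialHomeomorph.trans_source] at hx
  set x := (z.trans w).symm y with hxdef
  have hzx : z x = w.symm y := by
    rw [OpenPartialHomeomorph.trans_target] at hy
    exact z.right_inv hy.2
  have hxs : z.symm (w.symm y) = x := rfl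
  have hd : fderiv ℝ (z.trans w) x = (fderiv ℝ w (z x)).comp (fderiv ℝ z x) :=
    ((hw.hasFDerivAt hx.2).comp x (hz.hasFDerivAt hx.1)).fderiv
  ext α
  simp only [pushforward_apply]
  rw [hxs, ← hxdef, hd, hzx]
  rfl

lemma bracket_comp_chart {z : OpenPartialHomeomorph E F} (hz : IsSmoothChart z)
    (P : E → (E →L[ℝ] ℝ) →L[ℝ] E) {x : E} (hx : x ∈ z.source) {f g : F → ℝ}
    (hf : DifferentiableAt ℝ f (z x)) (hg : DifferentiableAt ℝ g (z x)) :
    bracket P (fun y => f (z y)) (fun y => g (z y)) x = bracket (pushforward z P) f g (z x) := by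
  have h1 : ∀ {f : F → ℝ}, DifferentiableAt ℝ f (z x) →
      fderiv ℝ (fun y => f (z y)) x = (fderiv ℝ f (z x)).comp (fderiv ℝ z x) := fun hf =>
    (hf.hasFDerivAt.comp x (hz.hasFDerivAt hx)).fderiv
  rw [bracket, bracket, h1 hf, h1 hg, pushforward_apply, z.left_inv hx]
  rfl

/-- Poisson bivectors are transported to Poisson bivectors. -/
theorem IsPoissonBivector.pushforward {P : E → (E →L[ℝ] ℝ) →L[ℝ] E} {U : Set E}
    (hP : IsPoissonBivector P U) {z : OpenPartialHomeomorph E F}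
    (hz : IsSmoothChart z) (hzU : z.source ⊆ U) :
    IsPoissonBivector (LieDarboux.pushforward z P) z.target := by
  have hsm : ContDiffOn ℝ ∞ (LieDarboux.pushforward z P) z.target := by
    have h1 : ContDiffOn ℝ ∞ (fderiv ℝ z) z.source :=
      ((contDiffOn_infty_iff_fderiv_of_isOpen z.open_source).1 hz.smooth).2
    have h2 : ContDiffOn ℝ ∞ (fun y => fderiv ℝ z (z.symm y)) z.target :=
      h1.comp hz.smooth_symm fun y hy => z.map_target hy
    have h3 : ContDiffOn ℝ ∞ (fun y => P (z.symm y)) z.target :=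
      hP.smooth.comp hz.smooth_symm fun y hy => hzU (z.map_target hy)
    have h4 : ContDiff ℝ ∞ (fun D : E →L[ℝ] F => (ContinuousLinearMap.compL ℝ E F ℝ).flip D) := by
      fun_prop
    exact h2.clm_comp (h3.clm_comp (h4.comp_contDiffOn h2))
  refine ⟨hsm, ?_, ?_⟩
  · intro y hy α β
    exact hP.antisymm _ (hzU (z.map_target hy)) (α.comp (fderiv ℝ z (z.symm y)))
      (β.comp (fderiv ℝ z (z.symm y)))
  · intro y hy f g h hf hg hh
    set x := z.symm y with hx
    have hxs : x ∈ z.source := z.map_target hy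
    have hzx : z x = y := z.right_inv hy
    have hcomp : ∀ {f : F → ℝ}, ContDiffAt ℝ 2 f y → ContDiffAt ℝ 2 (fun y => f (z y)) x := by
      intro f hf
      rw [← hzx] at hf
      exact hf.comp x ((hz.smooth.contDiffAt (z.open_source.mem_nhds hxs)).of_le (by norm_cast))
    have key : ∀ {f g h : F → ℝ}, ContDiffAt ℝ 2 f y → ContDiffAt ℝ 2 g y → ContDiffAt ℝ 2 h y →
        bracket P (fun y => f (z y)) (bracket P (fun y => g (z y)) (fun y => h (z y))) x
          = bracket (LieDarboux.pushforward z P) f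
              (bracket (LieDarboux.pushforward z P) g h) y := by
      intro f g h hf hg hh
      have hev : bracket P (fun y => g (z y)) (fun y => h (z y)) =ᶠ[𝓝 x]
          fun x' => bracket (LieDarboux.pushforward z P) g h (z x') := by
        have hzc : ContinuousAt z x := z.continuousAt hxs
        have h2 : ∀ {f : F → ℝ}, ContDiffAt ℝ 2 f y → ∀ᶠ x' in 𝓝 x, ContDiffAt ℝ 2 f (z x') := by
          intro f hf
          rw [← hzx] at hf
          exact hzc.eventually (hf.eventually (by simp))
        filter_upwards [z.open_source.mem_nhds hxs, h2 hg, h2 hh] with x' hx' hg' hh'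
        exact bracket_comp_chart hz P hx' (hg'.differentiableAt (by simp))
          (hh'.differentiableAt (by simp))
      rw [bracket, hev.fderiv_eq]
      have hf' := hf.differentiableAt (by simp)
      have hb : DifferentiableAt ℝ (bracket (LieDarboux.pushforward z P) g h) y :=
        bracket_differentiableAt (hsm.contDiffAt (z.open_target.mem_nhds hy)) hg hh
      rw [← hzx] at hf' hb
      have := bracket_comp_chart hz P hxs hf' hb
      rw [hzx] at this
      exact this
    rw [← key hf hg hh, ← key hg hh hf, ← key hh hf hg]
    exact hP.jacobi x (hzU hxs) _ _ _ (hcomp hf) (hcomp hg) (hcomp hh)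

end Bivector

/-! ### Splitting off canonical pairs -/

section Splitting

variable {E : Type u} [NormedAddCommGroup E] [NormedSpace ℝ E]

/-- `k` canonical pairs of linear functionals for the bivector `P` on `U`: `(p, q)` and `(u, v)`
are biorthogonal, and the Hamiltonian fields of `p i` and `q i` are the constant fields `v i` and
`-u i`. In other words, `u i = ∂/∂pⁱ` and `v i = ∂/∂qⁱ`, and these directions split off from `P`. -/
structure CanonicalPairs {k : ℕ} (P : E → (E →L[ℝ] ℝ) →L[ℝ] E) (U : Set E)
    (p q : Fin k → E →L[ℝ] ℝ) (u v : Fin k → E) : Prop where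
  p_u : ∀ i j, p i (u j) = if i = j then 1 else 0
  p_v : ∀ i j, p i (v j) = 0
  q_u : ∀ i j, q i (u j) = 0
  q_v : ∀ i j, q i (v j) = if i = j then 1 else 0
  hamiltonian_p : ∀ x ∈ U, ∀ i, P x (p i) = v i
  hamiltonian_q : ∀ x ∈ U, ∀ i, P x (q i) = -u i

/-- The projection `∑ᵢ (pⁱ ⊗ uᵢ + qⁱ ⊗ vᵢ)` onto the span of the vectors `uᵢ` and `vᵢ`. -/
noncomputable def pairProj {k : ℕ} (p q : Fin k → E →L[ℝ] ℝ) (u v : Fin k → E) : E →L[ℝ] E :=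
  ∑ i, ((p i).smulRight (u i) + (q i).smulRight (v i))

lemma pairProj_apply {k : ℕ} (p q : Fin k → E →L[ℝ] ℝ) (u v : Fin k → E) (x : E) :
    pairProj p q u v x = ∑ i, (p i x • u i + q i x • v i) := by
  simp [pairProj]

namespace CanonicalPairs

variable {k : ℕ} {P : E → (E →L[ℝ] ℝ) →L[ℝ] E} {U : Set E}
  {p q : Fin k → E →L[ℝ] ℝ} {u v : Fin k → E}

lemma pairProj_u (h : CanonicalPairs P U p q u v) (j : Fin k) : pairProj p q u v (u j) = u j := by
  simp [pairProj_apply, h.p_u, h.q_u]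

lemma pairProj_v (h : CanonicalPairs P U p q u v) (j : Fin k) : pairProj p q u v (v j) = v j := by
  simp [pairProj_apply, h.p_v, h.q_v]

lemma pairProj_pairProj (h : CanonicalPairs P U p q u v) (x : E) :
    pairProj p q u v (pairProj p q u v x) = pairProj p q u v x := by
  conv_lhs => rw [pairProj_apply p q u v x]
  simp only [map_sum, map_add, map_smul, h.pairProj_u, h.pairProj_v]
  rw [pairProj_apply]

lemma fderiv_hamiltonian_pairProj (h : CanonicalPairs P U p q u v) (hP : IsPoissonBivector P U)
    (hU : IsOpen U) (γ : E →L[ℝ] ℝ) {x : E} (hx : x ∈ U) (w : E) :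
    fderiv ℝ (fun y => P y γ) x (pairProj p q u v w) = 0 := by
  have hu : ∀ i, fderiv ℝ (fun y => P y γ) x (u i) = 0 := fun i => by
    rw [← neg_neg (u i), map_neg, hP.fderiv_hamiltonian_eq_zero hU
      (fun y hy => h.hamiltonian_q y hy i) γ hx, neg_zero]
  have hv : ∀ i, fderiv ℝ (fun y => P y γ) x (v i) = 0 := fun i =>
    hP.fderiv_hamiltonian_eq_zero hU (fun y hy => h.hamiltonian_p y hy i) γ hx
  rw [pairProj_apply]
  simp [hu, hv]

/-- `P` maps the functionals that factor through the projection into the span of the canonical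
directions. -/
lemma apply_comp_pairProj (h : CanonicalPairs P U p q u v) {x : E} (hx : x ∈ U)
    (β : E →L[ℝ] ℝ) :
    P x (β.comp (pairProj p q u v)) = ∑ i, (β (u i) • v i - β (v i) • u i) := by
  have h1 : β.comp (pairProj p q u v) = ∑ i, (β (u i) • p i + β (v i) • q i) := by
    ext w
    simp [pairProj_apply, mul_comm]
  rw [h1]
  simp [h.hamiltonian_p x hx, h.hamiltonian_q x hx, sub_eq_add_neg]

lemma comp_sub_apply_u (h : CanonicalPairs P U p q u v) (β : E →L[ℝ] ℝ) (i : Fin k) :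
    (β - β.comp (pairProj p q u v)) (u i) = 0 := by
  simp [h.pairProj_u]

lemma comp_sub_apply_v (h : CanonicalPairs P U p q u v) (β : E →L[ℝ] ℝ) (i : Fin k) :
    (β - β.comp (pairProj p q u v)) (v i) = 0 := by
  simp [h.pairProj_v]

/-- If the rank of `P` exceeds `2k`, then some functional that vanishes on the canonical directions
has a nonzero Hamiltonian vector. -/
lemma exists_hamiltonian_ne_zero (h : CanonicalPairs P U p q u v) {x : E} (hx : x ∈ U)
    (hrank : 2 * k < Module.finrank ℝ (LinearMap.range (P x).toLinearMap)) :
    ∃ α : E →L[ℝ] ℝ, (∀ i, α (u i) = 0) ∧ (∀ i, α (v i) = 0) ∧ P x α ≠ 0 := by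
  by_contra hcon
  push Not at hcon
  have hle : LinearMap.range (P x).toLinearMap
      ≤ Submodule.span ℝ (Set.range (Sum.elim u v)) := by
    rintro _ ⟨β, rfl⟩
    have h1 : P x β = P x (β.comp (pairProj p q u v)) := by
      rw [← sub_eq_zero, ← map_sub]
      exact hcon _ (h.comp_sub_apply_u β) (h.comp_sub_apply_v β)
    change P x β ∈ _
    rw [h1, h.apply_comp_pairProj hx]
    refine Submodule.sum_mem _ fun i _ => Submodule.sub_mem _ ?_ ?_
    · exact Submodule.smul_mem _ _ (Submodule.subset_span ⟨Sum.inr i, rfl⟩)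
    · exact Submodule.smul_mem _ _ (Submodule.subset_span ⟨Sum.inl i, rfl⟩)
  have h2 : Module.finrank ℝ (Submodule.span ℝ (Set.range (Sum.elim u v))) ≤ 2 * k := by
    refine (finrank_range_le_card (R := ℝ) (Sum.elim u v)).trans ?_
    simp [two_mul]
  have : FiniteDimensional ℝ (Submodule.span ℝ (Set.range (Sum.elim u v))) :=
    FiniteDimensional.span_of_finite ℝ (Set.finite_range _)
  exact absurd (Submodule.finrank_mono hle) (by omega)

end CanonicalPairs

/-- The Hamiltonian field of a linear functional `α` is straightened by a change of coordinates
that keeps every constant Hamiltonian field in the directions of the projection `ρ`. -/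
lemma exists_straighten_hamiltonian [CompleteSpace E] [HasContDiffBump E]
    {P : E → (E →L[ℝ] ℝ) →L[ℝ] E} {U : Set E} (hP : IsPoissonBivector P U) (hU : IsOpen U)
    (h0 : (0 : E) ∈ U) (α μ : E →L[ℝ] ℝ) (hμ : μ (P 0 α) = 1) (ρ : E →L[ℝ] E)
    (hρρ : ∀ x, ρ (ρ x) = ρ x) (hμρ : ∀ x, μ (ρ x) = 0) (hρα : ρ (P 0 α) = 0)
    (hinv : ∀ x ∈ U, ∀ w, fderiv ℝ (fun y => P y α) x (ρ w) = 0) :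
    ∃ z : OpenPartialHomeomorph E E, 0 ∈ z.source ∧ z 0 = 0 ∧ z.source ⊆ U ∧ IsSmoothChart z ∧
      (∀ y ∈ z.target, pushforward z P y α = P 0 α) ∧
      ∀ (β : E →L[ℝ] ℝ) (w : E), (∀ x ∈ U, P x β = w) → ρ w = w →
        ∀ y ∈ z.target, pushforward z P y β = w := by
  obtain ⟨Ψ, h0s, hΨ0, hΨU, hs, hs', hDρ, hDv, hν⟩ := exists_straightening hU h0
    (hP.smooth.clm_apply contDiffOn_const) rfl μ hμ ρ hρρ hμρ hρα hinv
  have hΨ : IsSmoothChart Ψ := ⟨hs, hs'⟩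
  -- a functional that `Ψ` preserves has the same Hamiltonian field in the new coordinates
  have key : ∀ β : E →L[ℝ] ℝ, (∀ y ∈ U, β (P y α) = β (P 0 α)) → ∀ y ∈ Ψ.source, ∀ w : E,
      fderiv ℝ Ψ y w = P (Ψ y) β → pushforward Ψ.symm P y β = w := by
    intro β hβ y hy w hw
    have h1 : β.comp (fderiv ℝ Ψ y) = β := by
      have h2 : (fun x => β (Ψ x)) =ᶠ[𝓝 y] β := by
        filter_upwards [Ψ.open_source.mem_nhds hy] with x hx using hν x hx β hβ
      exact (β.hasFDerivAt.comp y (hΨ.hasFDerivAt hy)).unique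
        (β.hasFDerivAt.congr_of_eventuallyEq h2)
    have h3 : β.comp (fderiv ℝ Ψ.symm (Ψ y)) = β := by
      ext x
      conv_lhs => rw [← h1]
      change β (fderiv ℝ Ψ y (fderiv ℝ Ψ.symm (Ψ y) x)) = β x
      rw [hΨ.fderiv_apply_symm hy]
    rw [pushforward_apply, OpenPartialHomeomorph.symm_symm, h3, ← hw, hΨ.fderiv_symm_apply hy]
  refine ⟨Ψ.symm, ?_, ?_, hΨU, hΨ.symm, ?_, ?_⟩
  · have := Ψ.map_source h0s
    rwa [hΨ0] at this
  · have := Ψ.left_inv h0s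
    rwa [hΨ0] at this
  · intro y hy
    refine key α (fun x hx => ?_) y hy _ (hDv y hy)
    have hzero : ∀ x ∈ U, α (P x α) = 0 := fun x hx => by
      have := hP.antisymm x hx α α
      linarith
    rw [hzero x hx, hzero 0 h0]
  · intro β w hw hρw y hy
    refine key β (fun x hx => ?_) y hy w ?_
    · rw [hP.antisymm x hx, hP.antisymm 0 h0, hw x hx, hw 0 h0]
    · rw [hw _ (hΨU (Ψ.map_source hy)), ← hρw]
      exact hDρ y hy w

/-- One more canonical pair is split off, as long as there is a functional `α` that vanishes on the
canonical directions and has a nonzero Hamiltonian vector at the origin: first the Hamiltonian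
field of `α` is made constant, then that of a conjugate functional `μ`. -/
theorem CanonicalPairs.exists_succ [CompleteSpace E] [HasContDiffBump E] {k : ℕ}
    {P : E → (E →L[ℝ] ℝ) →L[ℝ] E} {U : Set E} {p q : Fin k → E →L[ℝ] ℝ} {u v : Fin k → E}
    (h : CanonicalPairs P U p q u v) (hP : IsPoissonBivector P U) (hU : IsOpen U)
    (h0 : (0 : E) ∈ U) {α : E →L[ℝ] ℝ} (hαu : ∀ i, α (u i) = 0) (hαv : ∀ i, α (v i) = 0)
    (hα : P 0 α ≠ 0) :
    ∃ (z : OpenPartialHomeomorph E E) (p' q' : Fin (k + 1) → E →L[ℝ] ℝ) (u' v' : Fin (k + 1) → E),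
      0 ∈ z.source ∧ z 0 = 0 ∧ z.source ⊆ U ∧ IsSmoothChart z ∧
      CanonicalPairs (pushforward z P) z.target p' q' u' v' := by
  set ρ := pairProj p q u v with hρ
  set V : E := P 0 α with hV
  have hpV : ∀ i, p i V = 0 := fun i => by
    rw [hV, hP.antisymm 0 h0, h.hamiltonian_p 0 h0, hαv, neg_zero]
  have hqV : ∀ i, q i V = 0 := fun i => by
    rw [hV, hP.antisymm 0 h0, h.hamiltonian_q 0 h0, map_neg, hαu, neg_zero, neg_zero]
  have hρV : ρ V = 0 := by rw [hρ, pairProj_apply]; simp [hpV, hqV]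
  have hαρ : ∀ x, α (ρ x) = 0 := fun x => by rw [hρ, pairProj_apply]; simp [hαu, hαv]
  have hαV : α V = 0 := by
    have := hP.antisymm 0 h0 α α
    rw [hV]; linarith
  obtain ⟨μ₀, hμ₀⟩ := SeparatingDual.exists_eq_one (R := ℝ) hα
  let μ : E →L[ℝ] ℝ := μ₀ - μ₀.comp ρ
  have hμV : μ V = 1 := by
    change μ₀ V - μ₀ (ρ V) = 1
    rw [hρV, map_zero, sub_zero, hμ₀]
  have hμu : ∀ i, μ (u i) = 0 := h.comp_sub_apply_u μ₀
  have hμv : ∀ i, μ (v i) = 0 := h.comp_sub_apply_v μ₀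
  have hμρ : ∀ x, μ (ρ x) = 0 := fun x => by
    change μ₀ (ρ x) - μ₀ (ρ (ρ x)) = 0
    rw [hρ, h.pairProj_pairProj, sub_self]
  obtain ⟨z, h0z, hz0, hzU, hz, hzα, hzρ⟩ := exists_straighten_hamiltonian hP hU h0 α μ hμV ρ
    h.pairProj_pairProj hμρ hρV fun x hx w => h.fderiv_hamiltonian_pairProj hP hU α hx w
  set P₁ := pushforward z P with hP₁def
  have hP₁ : IsPoissonBivector P₁ z.target := hP.pushforward hz hzU
  have h0₁ : (0 : E) ∈ z.target := by
    have := z.map_source h0z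
    rwa [hz0] at this
  have h₁ : CanonicalPairs P₁ z.target p q u v :=
    ⟨h.p_u, h.p_v, h.q_u, h.q_v,
      fun y hy i => hzρ (p i) (v i) (fun x hx => h.hamiltonian_p x hx i) (h.pairProj_v i) y hy,
      fun y hy i => hzρ (q i) (-u i) (fun x hx => h.hamiltonian_q x hx i)
        (by rw [map_neg, hρ, h.pairProj_u]) y hy⟩
  -- the second Hamiltonian field, of `-μ`, with the time function `α`
  set W : E := P₁ 0 (-μ) with hW
  have hαW : α W = 1 := by
    rw [hW, hP₁.antisymm 0 h0₁, hzα 0 h0₁]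
    change - -(μ V) = 1
    rw [neg_neg, hμV]
  have hμW : μ W = 0 := by
    have := hP₁.antisymm 0 h0₁ μ (-μ)
    rw [map_neg, neg_apply, neg_neg] at this
    rw [hW, map_neg, map_neg]
    rw [map_neg] at this
    linarith
  have hpW : ∀ i, p i W = 0 := fun i => by
    rw [hW, hP₁.antisymm 0 h0₁, h₁.hamiltonian_p 0 h0₁]
    change - -(μ (v i)) = 0
    rw [hμv, neg_zero, neg_zero]
  have hqW : ∀ i, q i W = 0 := fun i => by
    rw [hW, hP₁.antisymm 0 h0₁, h₁.hamiltonian_q 0 h0₁]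
    change - -(μ (-u i)) = 0
    rw [map_neg, hμu, neg_zero, neg_zero, neg_zero]
  have hρW : ρ W = 0 := by rw [hρ, pairProj_apply]; simp [hpW, hqW]
  let ρ' : E →L[ℝ] E := ρ + μ.smulRight V
  have hρ' : ∀ x, ρ' x = ρ x + μ x • V := fun x => rfl
  have hρρ : ∀ x, ρ (ρ x) = ρ x := h.pairProj_pairProj
  obtain ⟨w, h0w, hw0, hwU, hw, hwμ, hwρ⟩ := exists_straighten_hamiltonian hP₁ z.open_target h0₁
    (-μ) α hαW ρ' (fun x => by simp [hρ', hρρ, hρV, hμρ, hμV])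
    (fun x => by simp [hρ', hαρ, hαV]) (by rw [← hW, hρ', hρW, hμW, zero_smul, zero_add])
    (fun x hx y => by
      rw [hρ', map_add, map_smul, h₁.fderiv_hamiltonian_pairProj hP₁ z.open_target _ hx,
        hP₁.fderiv_hamiltonian_eq_zero z.open_target hzα _ hx, smul_zero, zero_add])
  have hsrc : (z.trans w).source = z.source ∩ z ⁻¹' w.source := z.trans_source w
  have hpush : ∀ y ∈ (z.trans w).target, pushforward (z.trans w) P y = pushforward w P₁ y :=
    fun y hy => pushforward_trans hz hw P hy
  have htgt : ∀ y ∈ (z.trans w).target, y ∈ w.target := fun y hy => by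
    rw [OpenPartialHomeomorph.trans_target] at hy
    exact hy.1
  have hρ'u : ∀ i, ρ' (u i) = u i := fun i => by
    rw [hρ', hμu, zero_smul, add_zero, hρ, h.pairProj_u]
  have hρ'v : ∀ i, ρ' (v i) = v i := fun i => by
    rw [hρ', hμv, zero_smul, add_zero, hρ, h.pairProj_v]
  have hρ'V : ρ' V = V := by rw [hρ', hρV, hμV, one_smul, zero_add]
  refine ⟨z.trans w, Fin.cons α p, Fin.cons μ q, Fin.cons W u, Fin.cons V v, ?_, ?_, ?_,
    hz.trans hw, ?_⟩
  · rw [hsrc]; exact ⟨h0z, by rw [Set.mem_preimage, hz0]; exact h0w⟩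
  · change w (z 0) = 0
    rw [hz0, hw0]
  · rw [hsrc]; exact Set.inter_subset_left.trans hzU
  · refine ⟨?_, ?_, ?_, ?_, ?_, ?_⟩
    · intro i j
      cases i using Fin.cases <;> cases j using Fin.cases <;>
        simp [hαW, hαu, hpW, h.p_u, (Fin.succ_ne_zero _).symm]
    · intro i j
      cases i using Fin.cases <;> cases j using Fin.cases <;> simp [hαV, hαv, hpV, h.p_v]
    · intro i j
      cases i using Fin.cases <;> cases j using Fin.cases <;> simp [hμW, hμu, hqW, h.q_u]
    · intro i j
      cases i using Fin.cases <;> cases j using Fin.cases <;>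
        simp [hμV, hμv, hqV, h.q_v, (Fin.succ_ne_zero _).symm]
    · intro y hy i
      rw [hpush y hy]
      cases i using Fin.cases with
      | zero => exact hwρ α V hzα hρ'V y (htgt y hy)
      | succ i =>
        exact hwρ (p i) (v i) (fun x hx => h₁.hamiltonian_p x hx i) (hρ'v i) y (htgt y hy)
    · intro y hy i
      rw [hpush y hy]
      cases i using Fin.cases with
      | zero =>
        have := hwμ y (htgt y hy)
        rw [map_neg, neg_eq_iff_eq_neg, ← hW] at this
        exact this
      | succ i =>
        exact hwρ (q i) (-u i) (fun x hx => h₁.hamiltonian_q x hx i)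
          (by rw [map_neg, hρ'u]) y (htgt y hy)

lemma finrank_range_pushforward {P : E → (E →L[ℝ] ℝ) →L[ℝ] E} {z : OpenPartialHomeomorph E E}
    (hz : IsSmoothChart z) {y : E} (hy : y ∈ z.target) :
    Module.finrank ℝ (LinearMap.range (pushforward z P y).toLinearMap)
      = Module.finrank ℝ (LinearMap.range (P (z.symm y)).toLinearMap) := by
  have hx : z.symm y ∈ z.source := z.map_target hy
  set x := z.symm y with hxdef
  let D : E ≃ₗ[ℝ] E := LinearEquiv.ofLinearMap (fderiv ℝ z x).toLinearMap
    (fderiv ℝ z.symm (z x)).toLinearMap (LinearMap.ext fun w => hz.fderiv_apply_symm hx w)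
    (LinearMap.ext fun w => hz.fderiv_symm_apply hx w)
  have hrange : LinearMap.range (pushforward z P y).toLinearMap
      = (LinearMap.range (P x).toLinearMap).map (D : E →ₗ[ℝ] E) := by
    apply le_antisymm
    · rintro _ ⟨α, rfl⟩
      exact ⟨P x (α.comp (fderiv ℝ z x)), ⟨_, rfl⟩, rfl⟩
    · rintro _ ⟨_, ⟨β, rfl⟩, rfl⟩
      refine ⟨β.comp (fderiv ℝ z.symm (z x)), ?_⟩
      change fderiv ℝ z x (P x ((β.comp (fderiv ℝ z.symm (z x))).comp (fderiv ℝ z x)))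
        = fderiv ℝ z x (P x β)
      congr 2
      ext w
      exact congrArg β (hz.fderiv_symm_apply hx w)
  rw [hrange]
  exact LinearEquiv.finrank_map_eq D _

/-- Near a point around which it has constant rank at least `2k`, a Poisson bivector has `k`
canonical pairs in suitable coordinates. -/
theorem exists_canonicalPairs [CompleteSpace E] [HasContDiffBump E]
    {P : E → (E →L[ℝ] ℝ) →L[ℝ] E} {U : Set E} (hP : IsPoissonBivector P U) (hU : IsOpen U)
    {x₀ : E} (h0 : x₀ ∈ U) (k : ℕ)
    (hrank : 2 * k ≤ Module.finrank ℝ (LinearMap.range (P x₀).toLinearMap)) :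
    ∃ (z : OpenPartialHomeomorph E E) (p q : Fin k → E →L[ℝ] ℝ) (u v : Fin k → E),
      x₀ ∈ z.source ∧ z x₀ = 0 ∧ z.source ⊆ U ∧ IsSmoothChart z ∧
      CanonicalPairs (pushforward z P) z.target p q u v := by
  induction k with
  | zero =>
    let t : OpenPartialHomeomorph E E := (Homeomorph.addRight (-x₀)).toOpenPartialHomeomorph
    refine ⟨t.restrOpen U hU, Fin.elim0, Fin.elim0, Fin.elim0, Fin.elim0,
      ⟨Set.mem_univ _, h0⟩, add_neg_cancel x₀, fun x hx => hx.2, ⟨?_, ?_⟩, ?_⟩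
    · exact (contDiff_id.add contDiff_const : ContDiff ℝ ∞ fun x : E => x + -x₀).contDiffOn
    · exact (contDiff_id.add contDiff_const : ContDiff ℝ ∞ fun x : E => x + - -x₀).contDiffOn
    · exact ⟨fun i => i.elim0, fun i => i.elim0, fun i => i.elim0, fun i => i.elim0,
        fun _ _ i => i.elim0, fun _ _ i => i.elim0⟩
  | succ k ih =>
    obtain ⟨z, p, q, u, v, hxz, hz0, hzU, hz, h⟩ := ih (by omega)
    have h0t : (0 : E) ∈ z.target := by
      have := z.map_source hxz
      rwa [hz0] at this
    have hsymm0 : z.symm 0 = x₀ := by rw [← hz0]; exact z.left_inv hxz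
    obtain ⟨α, hαu, hαv, hα⟩ := h.exists_hamiltonian_ne_zero h0t (by
      rw [finrank_range_pushforward hz h0t, hsymm0]; omega)
    obtain ⟨w, p', q', u', v', h0w, hw0, hwU, hw, h'⟩ :=
      h.exists_succ (hP.pushforward hz hzU) z.open_target h0t hαu hαv hα
    refine ⟨z.trans w, p', q', u', v', ?_, ?_, ?_, hz.trans hw, h'.p_u, h'.p_v, h'.q_u, h'.q_v,
      ?_, ?_⟩
    · rw [z.trans_source w]; exact ⟨hxz, by rw [Set.mem_preimage, hz0]; exact h0w⟩
    · change w (z x₀) = 0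
      rw [hz0, hw0]
    · rw [z.trans_source w]; exact Set.inter_subset_left.trans hzU
    all_goals
      intro y hy i
      rw [pushforward_trans hz hw P hy]
      rw [OpenPartialHomeomorph.trans_target] at hy
    · exact h'.hamiltonian_p y hy.1 i
    · exact h'.hamiltonian_q y hy.1 i

end Splitting

/-! ### Tensors are determined by their values -/

section TensorExt

variable {V : Type*} [AddCommGroup V] [Module ℝ V] {ι : Type*}

lemma tensor_ext_of_basis (b : Module.Basis ι ℝ V) {s t : V ⊗[ℝ] V}
    (h : ∀ i j, TensorProduct.dualDistrib ℝ V V (b.coord i ⊗ₜ b.coord j) s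
      = TensorProduct.dualDistrib ℝ V V (b.coord i ⊗ₜ b.coord j) t) : s = t := by
  have key : ∀ (t : V ⊗[ℝ] V) (i j : ι), (b.tensorProduct b).repr t (i, j)
      = TensorProduct.dualDistrib ℝ V V (b.coord i ⊗ₜ b.coord j) t := by
    intro t i j
    induction t with
    | zero => simp
    | tmul x y => simp [Module.Basis.tensorProduct_repr_tmul_apply, mul_comm]
    | add x y hx hy => simp only [map_add, Finsupp.add_apply, hx, hy]
  refine (b.tensorProduct b).repr.injective (Finsupp.ext fun ij => ?_)
  rw [← Prod.mk.eta (p := ij), key, key, h]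

lemma cotensor_ext_of_basis [Finite ι] (b : Module.Basis ι ℝ V)
    {s t : Module.Dual ℝ V ⊗[ℝ] Module.Dual ℝ V}
    (h : ∀ i j, cotensorEval s (b i) (b j) = cotensorEval t (b i) (b j)) : s = t := by
  classical
  have key : ∀ (t : Module.Dual ℝ V ⊗[ℝ] Module.Dual ℝ V) (i j : ι),
      (b.dualBasis.tensorProduct b.dualBasis).repr t (i, j) = cotensorEval t (b i) (b j) := by
    intro t i j
    unfold cotensorEval
    induction t with
    | zero => simp
    | tmul x y =>
      simp [Module.Basis.tensorProduct_repr_tmul_apply, Module.Basis.dualBasis_repr, mul_comm]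
    | add x y hx hy => simp only [map_add, Finsupp.add_apply, LinearMap.add_apply, hx, hy]
  refine (b.dualBasis.tensorProduct b.dualBasis).repr.injective (Finsupp.ext fun ij => ?_)
  rw [← Prod.mk.eta (p := ij), key, key, h]

end TensorExt

/-! ### Poisson operators as Poisson bivectors -/

section Operator

variable {n : ℕ}

lemma contDiff_smul_clm {E F : Type*} [NormedAddCommGroup E] [NormedSpace ℝ E]
    [NormedAddCommGroup F] [NormedSpace ℝ F] (T : E →L[ℝ] F) :
    ContDiff ℝ ∞ (fun c : ℝ => c • T) :=
  contDiff_id.smul contDiff_const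

/-- The map `β ↦ J^{ij} β_j ∂_i` given by a matrix `A = (J^{ij})`. -/
noncomputable def matrixBivector (A : Matrix (Fin n) (Fin n) ℝ) :
    ((Fin n → ℝ) →L[ℝ] ℝ) →L[ℝ] (Fin n → ℝ) :=
  ∑ i, ∑ j, A i j • ((ContinuousLinearMap.apply ℝ ℝ (Pi.single j 1 : Fin n → ℝ)).smulRight
    (Pi.single i 1 : Fin n → ℝ))

lemma matrixBivector_apply (A : Matrix (Fin n) (Fin n) ℝ) (β : (Fin n → ℝ) →L[ℝ] ℝ) :
    matrixBivector A β = A.mulVec fun j => β (Pi.single j 1) := by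
  ext i
  simp [matrixBivector, Matrix.mulVec, dotProduct, Finset.sum_apply, Pi.single_apply, mul_comm]

lemma apply_matrixBivector (A : Matrix (Fin n) (Fin n) ℝ) (α β : (Fin n → ℝ) →L[ℝ] ℝ) :
    α (matrixBivector A β) = ∑ i, ∑ j, A i j * α (Pi.single i 1) * β (Pi.single j 1) := by
  simp only [matrixBivector, sum_apply, smul_apply, map_sum, map_smul, smul_eq_mul,
    ContinuousLinearMap.smulRight_apply, ContinuousLinearMap.apply_apply]
  exact Finset.sum_congr rfl fun i _ => Finset.sum_congr rfl fun j _ => by ring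

lemma finrank_range_matrixBivector (A : Matrix (Fin n) (Fin n) ℝ) :
    Module.finrank ℝ (LinearMap.range (matrixBivector A).toLinearMap) = A.rank := by
  have : LinearMap.range (matrixBivector A).toLinearMap = LinearMap.range A.mulVecLin := by
    apply le_antisymm
    · rintro _ ⟨β, rfl⟩
      exact ⟨fun j => β (Pi.single j 1), (matrixBivector_apply A β).symm⟩
    · rintro _ ⟨w, rfl⟩
      refine ⟨∑ j, w j • ContinuousLinearMap.proj (R := ℝ) (φ := fun _ : Fin n => ℝ) j, ?_⟩
      change matrixBivector A _ = A.mulVec w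
      rw [matrixBivector_apply]
      congr 1
      ext j
      simp [Pi.single_apply, sum_apply]
  rw [this]
  rfl

/-- A Poisson operator defines a Poisson bivector. -/
theorem IsPoissonOn.isPoissonBivector {J : (Fin n → ℝ) → Matrix (Fin n) (Fin n) ℝ}
    {Ω : Set (Fin n → ℝ)} (hJ : IsPoissonOn J Ω) (hΩ : IsOpen Ω) :
    IsPoissonBivector (fun x => matrixBivector (J x)) Ω := by
  have hsm : ContDiffOn ℝ ∞ (fun x => matrixBivector (J x)) Ω := by
    unfold matrixBivector
    exact ContDiffOn.sum fun i _ => ContDiffOn.sum fun j _ =>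
      (contDiff_smul_clm _).comp_contDiffOn (hJ.smooth i j)
  have hanti : ∀ x ∈ Ω, ∀ α β : (Fin n → ℝ) →L[ℝ] ℝ,
      α (matrixBivector (J x) β) = -β (matrixBivector (J x) α) := by
    intro x hx α β
    rw [apply_matrixBivector, apply_matrixBivector, Finset.sum_comm, ← Finset.sum_neg_distrib]
    refine Finset.sum_congr rfl fun j _ => ?_
    rw [← Finset.sum_neg_distrib]
    refine Finset.sum_congr rfl fun i _ => ?_
    rw [hJ.antisymm x hx i j]
    ring
  refine ⟨hsm, hanti, fun x hx f g h hf hg hh => ?_⟩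
  have hJd : ∀ i j, DifferentiableAt ℝ (fun y => J y i j) x := fun i j =>
    ((hJ.smooth i j).contDiffAt (hΩ.mem_nhds hx)).differentiableAt (by simp)
  refine jacobi_of_const (hsm.contDiffAt (hΩ.mem_nhds hx)) (hanti x hx) ?_ hf hg hh
  -- the components of the derivative of the bivector field along a Hamiltonian vector
  have hcomp : ∀ α β γ : (Fin n → ℝ) →L[ℝ] ℝ,
      β (fderiv ℝ (fun x => matrixBivector (J x)) x (matrixBivector (J x) α) γ)
        = -∑ i, ∑ j, ∑ k, α (Pi.single i 1) * β (Pi.single j 1) * γ (Pi.single k 1)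
            * ∑ l, J x i l * partialDeriv l (fun y => J y j k) x := by
    intro α β γ
    have h1 : HasFDerivAt (fun y => β (matrixBivector (J y) γ))
        (∑ j, ∑ k, (β (Pi.single j 1) * γ (Pi.single k 1)) • fderiv ℝ (fun y => J y j k) x) x := by
      have h2 : (fun y => β (matrixBivector (J y) γ)) = fun y => ∑ j, ∑ k,
          J y j k * (β (Pi.single j 1) * γ (Pi.single k 1)) := by
        funext y
        rw [apply_matrixBivector]
        simp only [mul_assoc]
      rw [h2]
      exact HasFDerivAt.fun_sum fun j _ => HasFDerivAt.fun_sum fun k _ =>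
        (hJd j k).hasFDerivAt.mul_const _
    have h3 : HasFDerivAt (fun y => β (matrixBivector (J y) γ)) _ x :=
      β.hasFDerivAt.comp x ((((hsm.contDiffAt (hΩ.mem_nhds hx)).differentiableAt
        (by simp)).hasFDerivAt).clm_apply (hasFDerivAt_const γ x))
    have h4 := congrArg (fun A : (Fin n → ℝ) →L[ℝ] ℝ => A (matrixBivector (J x) α)) (h3.unique h1)
    have h5 : β (fderiv ℝ (fun x => matrixBivector (J x)) x (matrixBivector (J x) α) γ)
        = ∑ j, ∑ k, (β (Pi.single j 1) * γ (Pi.single k 1))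
            * fderiv ℝ (fun y => J y j k) x (matrixBivector (J x) α) := by
      simpa [sum_apply] using h4
    have h6 : ∀ j k, fderiv ℝ (fun y => J y j k) x (matrixBivector (J x) α)
        = -∑ i, α (Pi.single i 1) * ∑ l, J x i l * partialDeriv l (fun y => J y j k) x := by
      intro j k
      rw [Finset.sum_congr rfl fun i _ => Finset.mul_sum _ _ _]
      rw [apply_matrixBivector, Finset.sum_comm, ← Finset.sum_neg_distrib]
      refine Finset.sum_congr rfl fun i _ => ?_
      rw [← Finset.sum_neg_distrib]
      refine Finset.sum_congr rfl fun l _ => ?_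
      rw [hJ.antisymm x hx l i, partialDeriv]
      ring
    rw [h5]
    simp only [h6]
    calc _ = -∑ j, ∑ k, ∑ i, α (Pi.single i 1) * β (Pi.single j 1) * γ (Pi.single k 1)
            * ∑ l, J x i l * partialDeriv l (fun y => J y j k) x := by
          simp only [mul_neg, Finset.sum_neg_distrib, Finset.mul_sum]
          congr 1
          refine Finset.sum_congr rfl fun j _ => Finset.sum_congr rfl fun k _ =>
            Finset.sum_congr rfl fun i _ => Finset.sum_congr rfl fun l _ => ?_
          ring
      _ = _ := by
          congr 1
          rw [Finset.sum_congr rfl fun j _ => Finset.sum_comm]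
          exact Finset.sum_comm
  intro α β γ
  rw [hcomp, hcomp, hcomp]
  have e2 : ∀ F : Fin n → Fin n → Fin n → ℝ,
      ∑ j, ∑ k, ∑ i, F i j k = ∑ i, ∑ j, ∑ k, F i j k := fun F => by
    rw [Finset.sum_congr rfl fun j _ => Finset.sum_comm]
    exact Finset.sum_comm
  have e3 : ∀ F : Fin n → Fin n → Fin n → ℝ,
      ∑ k, ∑ i, ∑ j, F i j k = ∑ i, ∑ j, ∑ k, F i j k := fun F => by
    rw [Finset.sum_comm]
    exact Finset.sum_congr rfl fun i _ => Finset.sum_comm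
  rw [e2 fun i j k => β (Pi.single j 1) * γ (Pi.single k 1) * α (Pi.single i 1)
      * ∑ l, J x j l * partialDeriv l (fun y => J y k i) x,
    e3 fun i j k => γ (Pi.single k 1) * α (Pi.single i 1) * β (Pi.single j 1)
      * ∑ l, J x k l * partialDeriv l (fun y => J y i j) x,
    ← neg_add, ← neg_add, neg_eq_zero]
  simp only [← Finset.sum_add_distrib]
  refine Finset.sum_eq_zero fun i _ => Finset.sum_eq_zero fun j _ =>
    Finset.sum_eq_zero fun k _ => ?_
  have h7 := hJ.jacobi x hx i j k
  rw [Finset.sum_add_distrib, Finset.sum_add_distrib] at h7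
  linear_combination (α (Pi.single i 1) * β (Pi.single j 1) * γ (Pi.single k 1)) * h7

end Operator

/-! ### Lie–Darboux coordinates from a complete set of canonical pairs -/

section LinearCoordinates

variable {n r m : ℕ}

/-- If the rank of `P` is `2r`, then `r` canonical pairs exhaust the image of `P`: functionals that
vanish on the canonical directions are Casimir invariants. -/
lemma CanonicalPairs.hamiltonian_eq_zero {E : Type*} [NormedAddCommGroup E] [NormedSpace ℝ E]
    [FiniteDimensional ℝ E]
    {P : E → (E →L[ℝ] ℝ) →L[ℝ] E} {U : Set E} {p q : Fin r → E →L[ℝ] ℝ} {u v : Fin r → E}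
    (h : CanonicalPairs P U p q u v) (hP : IsPoissonBivector P U) {x : E} (hx : x ∈ U)
    (hrank : Module.finrank ℝ (LinearMap.range (P x).toLinearMap) = 2 * r)
    {α : E →L[ℝ] ℝ} (hαu : ∀ i, α (u i) = 0) (hαv : ∀ i, α (v i) = 0) : P x α = 0 := by
  have hli : LinearIndependent ℝ (Sum.elim u v) := by
    rw [Fintype.linearIndependent_iff]
    intro g hg s
    rw [Fintype.sum_sum_type] at hg
    cases s with
    | inl i => simpa [h.p_u, h.p_v] using congrArg (p i) hg
    | inr i => simpa [h.q_u, h.q_v] using congrArg (q i) hg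
  have hle : Submodule.span ℝ (Set.range (Sum.elim u v))
      ≤ LinearMap.range (P x).toLinearMap := by
    rw [Submodule.span_le]
    rintro _ ⟨i | i, rfl⟩
    · exact ⟨-q i, by simp [h.hamiltonian_q x hx]⟩
    · exact ⟨p i, h.hamiltonian_p x hx i⟩
  have heq := Submodule.eq_of_le_of_finrank_eq hle (by
    rw [hrank, finrank_span_eq_card hli]; simp [two_mul])
  have hproj : ∀ w ∈ Submodule.span ℝ (Set.range (Sum.elim u v)), pairProj p q u v w = w := by
    intro w hw
    induction hw using Submodule.span_induction with
    | mem w hw =>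
      obtain ⟨i | i, rfl⟩ := hw
      · exact h.pairProj_u i
      · exact h.pairProj_v i
    | zero => exact map_zero _
    | add w w' _ _ hw hw' => rw [map_add, hw, hw']
    | smul c w _ hw => rw [map_smul, hw]
  have hmem : P x α ∈ Submodule.span ℝ (Set.range (Sum.elim u v)) := by
    rw [heq]; exact ⟨α, rfl⟩
  rw [← hproj _ hmem, pairProj_apply]
  refine Finset.sum_eq_zero fun i _ => ?_
  rw [hP.antisymm x hx (p i), hP.antisymm x hx (q i), h.hamiltonian_p x hx,
    h.hamiltonian_q x hx, map_neg, hαu, hαv]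
  simp

/-- Biorthogonal families `(p, q)` and `(u, v)` are completed to a linear coordinate system by
functionals that vanish on all `u i` and `v i`. -/
lemma CanonicalPairs.exists_linear_coordinates {E : Type*} [NormedAddCommGroup E]
    [NormedSpace ℝ E] [FiniteDimensional ℝ E] (hn : Module.finrank ℝ E = 2 * r + m)
    {P : E → (E →L[ℝ] ℝ) →L[ℝ] E} {U : Set E} {p q : Fin r → E →L[ℝ] ℝ} {u v : Fin r → E}
    (h : CanonicalPairs P U p q u v) :
    ∃ L : E ≃L[ℝ] (Idx r m → ℝ), (∀ x i, L x (pIdx i) = p i x) ∧ (∀ x i, L x (qIdx i) = q i x) ∧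
      (∀ i, L (u i) = Pi.single (pIdx i) 1) ∧ (∀ i, L (v i) = Pi.single (qIdx i) 1) := by
  let A : E →ₗ[ℝ] (Fin r ⊕ Fin r → ℝ) :=
    LinearMap.pi (Sum.elim (fun i => (p i).toLinearMap) (fun i => (q i).toLinearMap))
  have hAp : ∀ x i, A x (Sum.inl i) = p i x := fun _ _ => rfl
  have hAq : ∀ x i, A x (Sum.inr i) = q i x := fun _ _ => rfl
  have hsurj : LinearMap.range A = ⊤ := by
    rw [LinearMap.range_eq_top]
    intro a
    refine ⟨∑ i, (a (Sum.inl i) • u i + a (Sum.inr i) • v i), ?_⟩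
    ext s
    cases s with
    | inl i => rw [hAp]; simp [h.p_u, h.p_v]
    | inr i => rw [hAq]; simp [h.q_u, h.q_v]
  have hker : Module.finrank ℝ (LinearMap.ker A) = m := by
    have h1 := LinearMap.finrank_range_add_finrank_ker A
    rw [hsurj, finrank_top, Module.finrank_fintype_fun_eq_card, hn] at h1
    simp only [Fintype.card_sum, Fintype.card_fin] at h1
    omega
  let b : Module.Basis (Fin m) ℝ (LinearMap.ker A) := Module.finBasisOfFinrankEq ℝ _ hker
  have hmem : ∀ x, x - pairProj p q u v x ∈ LinearMap.ker A := by
    intro x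
    rw [LinearMap.mem_ker]
    ext s
    cases s with
    | inl i => rw [hAp]; simp [pairProj_apply, h.p_u, h.p_v]
    | inr i => rw [hAq]; simp [pairProj_apply, h.q_u, h.q_v]
  let B : E →ₗ[ℝ] LinearMap.ker A :=
    LinearMap.codRestrict _ (LinearMap.id - (pairProj p q u v).toLinearMap) hmem
  let L₀ : E →ₗ[ℝ] (Idx r m → ℝ) :=
    LinearMap.pi (Sum.elim (fun i => (p i).toLinearMap)
      (Sum.elim (fun i => (q i).toLinearMap) (fun k => (b.coord k).comp B)))
  have hLp : ∀ x i, L₀ x (pIdx i) = p i x := fun _ _ => rfl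
  have hLq : ∀ x i, L₀ x (qIdx i) = q i x := fun _ _ => rfl
  have hLc : ∀ x k, L₀ x (cIdx k) = b.repr (B x) k := fun _ _ => rfl
  have hBx : ∀ x, (B x : E) = x - pairProj p q u v x := fun _ => rfl
  have hinj : Function.Injective L₀ := by
    rw [injective_iff_map_eq_zero]
    intro x hx
    have h1 : ∀ i, p i x = 0 := fun i => by rw [← hLp, hx]; rfl
    have h2 : ∀ i, q i x = 0 := fun i => by rw [← hLq, hx]; rfl
    have h3 : B x = 0 := by
      refine b.repr.injective (Finsupp.ext fun k => ?_)
      rw [← hLc, hx, map_zero]; rfl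
    have h4 : pairProj p q u v x = 0 := by rw [pairProj_apply]; simp [h1, h2]
    have h5 := hBx x
    rw [h3, h4, sub_zero] at h5
    exact h5.symm
  have hdim : Module.finrank ℝ E = Module.finrank ℝ (Idx r m → ℝ) := by
    rw [Module.finrank_fintype_fun_eq_card, hn]
    simp only [Fintype.card_sum, Fintype.card_fin]
    omega
  let L : E ≃L[ℝ] (Idx r m → ℝ) :=
    (LinearEquiv.ofInjectiveOfFinrankEq L₀ hinj hdim).toContinuousLinearEquiv
  have hL : ∀ x, L x = L₀ x := fun _ => rfl
  refine ⟨L, hLp, hLq, fun i => ?_, fun i => ?_⟩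
  · have hB : B (u i) = 0 := Subtype.ext (by rw [hBx, h.pairProj_u, sub_self]; rfl)
    ext (j | j | k)
    · rw [hL, hLp, h.p_u, Pi.single_apply]; simp
    · rw [hL, hLq, h.q_u, Pi.single_apply]; simp
    · rw [hL, hLc, hB, map_zero, Pi.single_apply]; simp
  · have hB : B (v i) = 0 := Subtype.ext (by rw [hBx, h.pairProj_v, sub_self]; rfl)
    ext (j | j | k)
    · rw [hL, hLp, h.p_v, Pi.single_apply]; simp
    · rw [hL, hLq, h.q_v, Pi.single_apply]; simp
    · rw [hL, hLc, hB, map_zero, Pi.single_apply]; simp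

end LinearCoordinates

/-! ### The coordinate frame of a chart -/

variable {n r m : ℕ}

section Frame

variable {z : Chart n r m} {x : Fin n → ℝ}

lemma IsLieDarboux.isSmoothChart {J : (Fin n → ℝ) → Matrix (Fin n) (Fin n) ℝ}
    (h : IsLieDarboux J z) : IsSmoothChart z := ⟨h.smooth, h.smooth_symm⟩

lemma IsSmoothChart.fderiv_coord (hz : IsSmoothChart z) (hx : x ∈ z.source) (a : Idx r m) :
    fderiv ℝ (fun y => z y a) x
      = (ContinuousLinearMap.proj (R := ℝ) (φ := fun _ : Idx r m => ℝ) a).comp (fderiv ℝ z x) :=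
  ((ContinuousLinearMap.proj (R := ℝ) (φ := fun _ : Idx r m => ℝ) a).hasFDerivAt.comp x
    (hz.hasFDerivAt hx)).fderiv

lemma IsSmoothChart.dCoord_apply (hz : IsSmoothChart z) (hx : x ∈ z.source) (a : Idx r m)
    (v : Fin n → ℝ) : dCoord z a x v = fderiv ℝ z x v a := by
  change fderiv ℝ (fun y => z y a) x v = _
  rw [hz.fderiv_coord hx]
  rfl

lemma IsSmoothChart.dCoord_coordVec (hz : IsSmoothChart z) (hx : x ∈ z.source) (a b : Idx r m) :
    dCoord z a x (coordVec z b x) = if a = b then 1 else 0 := by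
  rw [hz.dCoord_apply hx, coordVec, hz.fderiv_apply_symm hx, Pi.single_apply]

/-- The frame `∂/∂zᵃ` of coordinate tangent vectors, as a basis. -/
noncomputable def coordBasis (hz : IsSmoothChart z) (hx : x ∈ z.source) :
    Module.Basis (Idx r m) ℝ (Fin n → ℝ) :=
  (Pi.basisFun ℝ (Idx r m)).map
    (LinearEquiv.ofLinearMap (fderiv ℝ z.symm (z x)).toLinearMap (fderiv ℝ z x).toLinearMap
      (LinearMap.ext fun w => hz.fderiv_symm_apply hx w)
      (LinearMap.ext fun w => hz.fderiv_apply_symm hx w))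

lemma coordBasis_apply (hz : IsSmoothChart z) (hx : x ∈ z.source) (a : Idx r m) :
    coordBasis hz hx a = coordVec z a x := by
  simp [coordBasis, coordVec]

lemma coordBasis_coord (hz : IsSmoothChart z) (hx : x ∈ z.source) (a : Idx r m) :
    (coordBasis hz hx).coord a = dCoord z a x := by
  refine (coordBasis hz hx).ext fun b => ?_
  rw [Module.Basis.coord_apply, Module.Basis.repr_self, coordBasis_apply,
    hz.dCoord_coordVec hx, Finsupp.single_apply]
  simp only [eq_comm]

/-- The expansion of a tangent vector in the coordinate frame. -/
lemma IsSmoothChart.sum_coordVec (hz : IsSmoothChart z) (hx : x ∈ z.source) (v : Fin n → ℝ) :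
    ∑ a, dCoord z a x v • coordVec z a x = v := by
  have := (coordBasis hz hx).sum_repr v
  simpa only [← Module.Basis.coord_apply, coordBasis_coord, coordBasis_apply] using this

/-- The components of a bivector in a chart are its values on the coordinate covectors. -/
lemma chartComponents_eq (z : Chart n r m) (x : Fin n → ℝ)
    (J : (Fin n → ℝ) → Matrix (Fin n) (Fin n) ℝ) (a b : Idx r m) :
    chartComponents J z x a b
      = TensorProduct.dualDistrib ℝ _ _ (dCoord z a x ⊗ₜ dCoord z b x) (bivector (J x)) := by
  simp only [bivector, map_sum, map_smul, TensorProduct.dualDistrib_apply, smul_eq_mul]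
  refine Finset.sum_congr rfl fun i _ => Finset.sum_congr rfl fun j _ => ?_
  change dCoord z a x (Pi.single i 1) * J x i j * dCoord z b x (Pi.single j 1) = _
  ring

lemma chartComponents_eq_pushforward (hz : IsSmoothChart z) (hx : x ∈ z.source)
    (J : (Fin n → ℝ) → Matrix (Fin n) (Fin n) ℝ) (a b : Idx r m) :
    chartComponents J z x a b = pushforward z (fun x => matrixBivector (J x)) (z x)
      (ContinuousLinearMap.proj (R := ℝ) (φ := fun _ : Idx r m => ℝ) b) a := by
  rw [pushforward_apply, z.left_inv hx, ← hz.fderiv_coord hx b, ← hz.dCoord_apply hx a]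
  change _ = fderiv ℝ (fun y => z y a) x _
  rw [apply_matrixBivector, chartComponents]
  refine Finset.sum_congr rfl fun i _ => Finset.sum_congr rfl fun j _ => ?_
  rw [partialDeriv, partialDeriv]
  ring

/-- The values of `∑ᵢ ∂_{qⁱ} ∧ ∂_{pⁱ}` on the coordinate covectors. -/
lemma dualDistrib_canonical (hz : IsSmoothChart z) (hx : x ∈ z.source) (a b : Idx r m) :
    TensorProduct.dualDistrib ℝ _ _ (dCoord z a x ⊗ₜ dCoord z b x)
      (∑ i : Fin r, (coordVec z (qIdx i) x ⊗ₜ[ℝ] coordVec z (pIdx i) x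
        - coordVec z (pIdx i) x ⊗ₜ[ℝ] coordVec z (qIdx i) x))
      = ∑ i : Fin r, ((if a = qIdx i then 1 else 0) * (if b = pIdx i then 1 else 0)
          - (if a = pIdx i then 1 else 0) * (if b = qIdx i then 1 else 0)) := by
  simp only [map_sum, map_sub, TensorProduct.dualDistrib_apply, hz.dCoord_coordVec hx]

end Frame

/-! ### Existence of Lie–Darboux coordinates -/

section Existence

/-- **Darboux's theorem for Poisson operators of constant rank.** -/
theorem exists_isLieDarboux (hn : n = 2 * r + m) {Ω : Set (Fin n → ℝ)}
    {J : (Fin n → ℝ) → Matrix (Fin n) (Fin n) ℝ} (hΩ : IsOpen Ω) (hJ : IsPoissonOn J Ω)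
    {x₀ : Fin n → ℝ} (hx₀ : x₀ ∈ Ω) (hrank : ∀ᶠ x in 𝓝 x₀, (J x).rank = 2 * r) :
    ∃ z : Chart n r m, x₀ ∈ z.source ∧ z.source ⊆ Ω ∧ IsLieDarboux J z := by
  obtain ⟨U, hU, hUo, hxU⟩ := eventually_nhds_iff.1 (hrank.and (hΩ.mem_nhds hx₀))
  have hUΩ : U ⊆ Ω := fun x hx => (hU x hx).2
  set P : (Fin n → ℝ) → ((Fin n → ℝ) →L[ℝ] ℝ) →L[ℝ] (Fin n → ℝ) :=
    fun x => matrixBivector (J x) with hPdef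
  have hP : IsPoissonBivector P U := (hJ.isPoissonBivector hΩ).mono hUΩ
  have hPrank : ∀ x ∈ U, Module.finrank ℝ (LinearMap.range (P x).toLinearMap) = 2 * r :=
    fun x hx => by rw [hPdef, finrank_range_matrixBivector, (hU x hx).1]
  obtain ⟨z, p, q, u, v, hxz, -, hzU, hz, h⟩ :=
    exists_canonicalPairs hP hUo hxU r (hPrank x₀ hxU).ge
  obtain ⟨L, hLp, hLq, hLu, hLv⟩ := h.exists_linear_coordinates (m := m)
    (by rw [Module.finrank_fin_fun, hn])
  let w : OpenPartialHomeomorph (Fin n → ℝ) (Idx r m → ℝ) := L.toHomeomorph.toOpenPartialHomeomorph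
  have hw : IsSmoothChart w := ⟨L.contDiff.contDiffOn, L.symm.contDiff.contDiffOn⟩
  have hws : (z.trans w).source = z.source := by
    rw [OpenPartialHomeomorph.trans_source]; exact Set.inter_univ _
  have hsm : IsSmoothChart (z.trans w) := hz.trans hw
  let e : Idx r m → (Idx r m → ℝ) →L[ℝ] ℝ :=
    fun a => ContinuousLinearMap.proj (R := ℝ) (φ := fun _ : Idx r m => ℝ) a
  -- the bivector in the final coordinates
  have hpush : ∀ x ∈ z.source, ∀ a, pushforward (z.trans w) P (z.trans w x) (e a)
      = L (pushforward z P (z x) ((e a).comp (L : (Fin n → ℝ) →L[ℝ] (Idx r m → ℝ)))) := by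
    intro x hx a
    have hx' : x ∈ (z.trans w).source := by rw [hws]; exact hx
    rw [pushforward_trans hz hw P ((z.trans w).map_source hx'), pushforward_apply w]
    have h1 : w.symm ((z.trans w) x) = z x := w.left_inv (Set.mem_univ _)
    have h2 : fderiv ℝ w (z x) = (L : (Fin n → ℝ) →L[ℝ] (Idx r m → ℝ)) :=
      (L : (Fin n → ℝ) →L[ℝ] (Idx r m → ℝ)).fderiv
    rw [h1, h2]
    rfl
  have hQp : ∀ x ∈ z.source, ∀ i, pushforward (z.trans w) P (z.trans w x) (e (pIdx i))
      = Pi.single (qIdx i) 1 := by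
    intro x hx i
    have h1 : (e (pIdx i)).comp (L : (Fin n → ℝ) →L[ℝ] (Idx r m → ℝ)) = p i :=
      ContinuousLinearMap.ext fun y => hLp y i
    rw [hpush x hx, h1, h.hamiltonian_p _ (z.map_source hx), hLv]
  have hQq : ∀ x ∈ z.source, ∀ i, pushforward (z.trans w) P (z.trans w x) (e (qIdx i))
      = -Pi.single (pIdx i) 1 := by
    intro x hx i
    have h1 : (e (qIdx i)).comp (L : (Fin n → ℝ) →L[ℝ] (Idx r m → ℝ)) = q i :=
      ContinuousLinearMap.ext fun y => hLq y i
    rw [hpush x hx, h1, h.hamiltonian_q _ (z.map_source hx), map_neg, hLu]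
  have hQc : ∀ x ∈ z.source, ∀ k, pushforward (z.trans w) P (z.trans w x) (e (cIdx k)) = 0 := by
    intro x hx k
    have hzx := z.map_source hx
    rw [hpush x hx, h.hamiltonian_eq_zero (hP.pushforward hz hzU) hzx, map_zero]
    · rw [finrank_range_pushforward hz hzx, z.left_inv hx, hPrank x (hzU hx)]
    · intro i
      change L (u i) (cIdx k) = 0
      rw [hLu, Pi.single_apply]; simp
    · intro i
      change L (v i) (cIdx k) = 0
      rw [hLv, Pi.single_apply]; simp
  refine ⟨z.trans w, by rw [hws]; exact hxz, by rw [hws]; exact hzU.trans hUΩ,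
    hsm.smooth, hsm.smooth_symm, ?_, ?_⟩
  · intro x hx
    have hx' : x ∈ z.source := by rwa [hws] at hx
    refine tensor_ext_of_basis (coordBasis hsm hx) fun a b => ?_
    rw [coordBasis_coord, coordBasis_coord, dualDistrib_canonical hsm hx,
      ← chartComponents_eq, chartComponents_eq_pushforward hsm hx]
    change pushforward (z.trans w) P (z.trans w x) (e b) a = _
    rcases b with i | i | k
    · rw [hQp x hx' i, Pi.single_apply]
      simp
    · rw [hQq x hx' i, Pi.neg_apply, Pi.single_apply]
      simp
    · rw [hQc x hx' k]
      simp
  · intro x hx k i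
    have hx' : x ∈ z.source := by rwa [hws] at hx
    have h1 := hQc x hx' k
    rw [pushforward_apply, (z.trans w).left_inv hx, ← hsm.fderiv_coord hx (cIdx k)] at h1
    have h2 := congrArg (fderiv ℝ (z.trans w).symm (z.trans w x)) h1
    rw [hsm.fderiv_symm_apply hx, map_zero] at h2
    have h3 := congrFun h2 i
    rw [hPdef, matrixBivector_apply] at h3
    exact h3

end Existence

/-! ### The dissipative tensor and its inverse -/

section Dissipative

variable {J : (Fin n → ℝ) → Matrix (Fin n) (Fin n) ℝ} {z : Chart n r m} {x : Fin n → ℝ}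

lemma IsLieDarboux.chartComponents_apply (h : IsLieDarboux J z) (hx : x ∈ z.source)
    (a b : Idx r m) : chartComponents J z x a b
      = ∑ i : Fin r, ((if a = qIdx i then 1 else 0) * (if b = pIdx i then 1 else 0)
          - (if a = pIdx i then 1 else 0) * (if b = qIdx i then 1 else 0)) := by
  rw [chartComponents_eq, h.canonical x hx,
    dualDistrib_canonical h.isSmoothChart hx]

/-- In Lie–Darboux coordinates the dissipative components form the orthogonal projection onto the
`(p, q)` directions. -/
lemma IsLieDarboux.dissipativeMatrix_apply (h : IsLieDarboux J z) (hx : x ∈ z.source)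
    (a b : Idx r m) : dissipativeMatrix (chartComponents J z x) a b
      = ∑ i : Fin r, ((if a = pIdx i then 1 else 0) * (if b = pIdx i then 1 else 0)
          + (if a = qIdx i then 1 else 0) * (if b = qIdx i then 1 else 0)) := by
  simp only [dissipativeMatrix, h.chartComponents_apply hx]
  rcases a with i | i | k <;> rcases b with j | j | l <;>
    simp [Fintype.sum_sum_type]

theorem IsLieDarboux.dissipativeTensor_eq (h : IsLieDarboux J z) (hx : x ∈ z.source) :
    dissipativeTensor J z x = canonicalContra z x := by
  simp only [dissipativeTensor, canonicalContra, h.dissipativeMatrix_apply hx]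
  simp [Fintype.sum_sum_type, Finset.sum_add_distrib, ite_smul]

lemma flat_apply {E : Type*} [AddCommGroup E] [Module ℝ E]
    (h : Module.Dual ℝ E ⊗[ℝ] Module.Dual ℝ E) (v w : E) : flat h v w = cotensorEval h v w := by
  unfold flat cotensorEval
  induction h with
  | zero => simp
  | tmul α β => simp
  | add s t hs ht => simp only [map_add, LinearMap.add_apply, hs, ht]

lemma sharp_canonicalContra (α : Module.Dual ℝ (Fin n → ℝ)) :
    sharp (canonicalContra z x) α = ∑ i : Fin r, (α (coordVec z (pIdx i) x) • coordVec z (pIdx i) x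
      + α (coordVec z (qIdx i) x) • coordVec z (qIdx i) x) := by
  simp [sharp, canonicalContra]

lemma cotensorEval_canonicalMetric (v w : Fin n → ℝ) :
    cotensorEval (canonicalMetric z x) v w
      = ∑ i : Fin r, (dCoord z (pIdx i) x v * dCoord z (pIdx i) x w
        + dCoord z (qIdx i) x v * dCoord z (qIdx i) x w) := by
  simp [cotensorEval, canonicalMetric]

lemma flat_canonicalMetric (v : Fin n → ℝ) :
    flat (canonicalMetric z x) v = ∑ i : Fin r, (dCoord z (pIdx i) x v • dCoord z (pIdx i) x
        + dCoord z (qIdx i) x v • dCoord z (qIdx i) x) := by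
  simp [flat, canonicalMetric]

lemma mem_leafTangent {v : Fin n → ℝ} :
    v ∈ leafTangent z x ↔ ∀ k : Fin m, dCoord z (cIdx k) x v = 0 := by
  simp [leafTangent]

/-- A vector tangent to the leaves is a combination of the `∂/∂pⁱ` and `∂/∂qⁱ`. -/
lemma IsSmoothChart.sum_coordVec_leaf (hz : IsSmoothChart z) (hx : x ∈ z.source) {v : Fin n → ℝ}
    (hv : v ∈ leafTangent z x) :
    ∑ i : Fin r, (dCoord z (pIdx i) x v • coordVec z (pIdx i) x
      + dCoord z (qIdx i) x v • coordVec z (qIdx i) x) = v := by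
  conv_rhs => rw [← hz.sum_coordVec hx v]
  simp [Fintype.sum_sum_type, mem_leafTangent.1 hv, Finset.sum_add_distrib]

lemma IsSmoothChart.coordVec_mem_leafTangent (hz : IsSmoothChart z) (hx : x ∈ z.source)
    (i : Fin r) :
    coordVec z (pIdx i) x ∈ leafTangent z x ∧ coordVec z (qIdx i) x ∈ leafTangent z x := by
  simp [mem_leafTangent, hz.dCoord_coordVec hx]

lemma IsSmoothChart.isInverseOn_canonicalMetric (hz : IsSmoothChart z) (hx : x ∈ z.source) :
    IsInverseOn (leafTangent z x) (canonicalContra z x) (canonicalMetric z x) := by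
  refine ⟨fun α => ?_, fun v hv => ?_, fun α v hv => ?_⟩
  · rw [sharp_canonicalContra]
    exact Submodule.sum_mem _ fun i _ => Submodule.add_mem _
      (Submodule.smul_mem _ _ (hz.coordVec_mem_leafTangent hx i).1)
      (Submodule.smul_mem _ _ (hz.coordVec_mem_leafTangent hx i).2)
  · conv_rhs => rw [← hz.sum_coordVec_leaf hx hv]
    rw [sharp_canonicalContra, flat_canonicalMetric]
    simp [hz.dCoord_coordVec hx]
  · conv_rhs => rw [← hz.sum_coordVec_leaf hx hv]
    rw [sharp_canonicalContra, flat_canonicalMetric]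
    simp [hz.dCoord_coordVec hx, mul_comm]

/-- The inverse of `g` on the leaves is unique among the tensors without components along the
Casimir directions. -/
theorem IsLieDarboux.isInverseOn_iff (h : IsLieDarboux J z) (hx : x ∈ z.source)
    (t : Module.Dual ℝ (Fin n → ℝ) ⊗[ℝ] Module.Dual ℝ (Fin n → ℝ)) :
    (IsInverseOn (leafTangent z x) (dissipativeTensor J z x) t ∧
      ∀ (k : Fin m) (v : Fin n → ℝ), cotensorEval t (coordVec z (cIdx k) x) v = 0 ∧
        cotensorEval t v (coordVec z (cIdx k) x) = 0) ↔ t = canonicalMetric z x := by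
  have hz := h.isSmoothChart
  rw [h.dissipativeTensor_eq hx]
  constructor
  · rintro ⟨⟨-, hinv, -⟩, hC⟩
    have hp : ∀ α : Module.Dual ℝ (Fin n → ℝ), ∀ i,
        dCoord z (pIdx i) x (sharp (canonicalContra z x) α) = α (coordVec z (pIdx i) x) := by
      intro α i
      rw [sharp_canonicalContra]
      simp [hz.dCoord_coordVec hx]
    have hq : ∀ α : Module.Dual ℝ (Fin n → ℝ), ∀ i,
        dCoord z (qIdx i) x (sharp (canonicalContra z x) α) = α (coordVec z (qIdx i) x) := by
      intro α i
      rw [sharp_canonicalContra]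
      simp [hz.dCoord_coordVec hx]
    have hval : ∀ v ∈ leafTangent z x, ∀ b : Idx r m,
        cotensorEval t v (coordVec z b x)
          = cotensorEval (canonicalMetric z x) v (coordVec z b x) := by
      intro v hv b
      rcases b with i | i | k
      · rw [← flat_apply, ← hp, hinv v hv, cotensorEval_canonicalMetric]
        simp [hz.dCoord_coordVec hx]
      · rw [← flat_apply, ← hq, hinv v hv, cotensorEval_canonicalMetric]
        simp [hz.dCoord_coordVec hx]
      · rw [(hC k v).2, cotensorEval_canonicalMetric]
        simp [hz.dCoord_coordVec hx]
    refine cotensor_ext_of_basis (coordBasis hz hx) fun a b => ?_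
    rw [coordBasis_apply, coordBasis_apply]
    rcases a with i | i | k
    · exact hval _ (hz.coordVec_mem_leafTangent hx i).1 b
    · exact hval _ (hz.coordVec_mem_leafTangent hx i).2 b
    · rw [(hC k _).1, cotensorEval_canonicalMetric]
      simp [hz.dCoord_coordVec hx]
  · rintro rfl
    refine ⟨hz.isInverseOn_canonicalMetric hx, fun k v => ?_⟩
    rw [cotensorEval_canonicalMetric, cotensorEval_canonicalMetric]
    simp [hz.dCoord_coordVec hx]

theorem IsSmoothChart.isMetricOn_canonicalMetric (hz : IsSmoothChart z) (hx : x ∈ z.source) :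
    IsMetricOn (leafTangent z x) (canonicalMetric z x) := by
  refine ⟨fun v _ w _ => ?_, fun v hv hv0 => ?_⟩
  · rw [cotensorEval_canonicalMetric, cotensorEval_canonicalMetric]
    exact Finset.sum_congr rfl fun i _ => by ring
  · rw [cotensorEval_canonicalMetric]
    have hnn : ∀ i ∈ Finset.univ, 0 ≤ dCoord z (pIdx i) x v * dCoord z (pIdx i) x v
        + dCoord z (qIdx i) x v * dCoord z (qIdx i) x v := fun i _ =>
      add_nonneg (mul_self_nonneg _) (mul_self_nonneg _)
    refine lt_of_le_of_ne (Finset.sum_nonneg hnn) fun h0 => hv0 ?_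
    rw [← hz.sum_coordVec_leaf hx hv]
    refine Finset.sum_eq_zero fun i hi => ?_
    have h1 := mul_self_add_mul_self_eq_zero.1
      ((Finset.sum_eq_zero_iff_of_nonneg hnn).1 h0.symm i hi)
    rw [h1.1, h1.2, zero_smul, zero_smul, add_zero]

/-! ### The Euclidean structure of the leaves -/

theorem IsSmoothChart.isEuclideanOnLeaf (hz : IsSmoothChart z) (c : Fin m → ℝ) :
    IsEuclideanOnLeaf z c (canonicalMetric z) := by
  -- the parametrization of the leaf by `(p, q)`, in coordinates
  let ι : (Fin r ⊕ Fin r → ℝ) → (Idx r m → ℝ) := fun s =>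
    Sum.elim (fun i => s (Sum.inl i)) (Sum.elim (fun i => s (Sum.inr i)) c)
  have hι : ContDiff ℝ ∞ ι := by
    rw [contDiff_pi]
    rintro (i | i | k)
    · exact contDiff_apply ℝ ℝ (Sum.inl i)
    · exact contDiff_apply ℝ ℝ (Sum.inr i)
    · exact contDiff_const
  have hιz : ∀ x ∈ casimirLeaf z c, ι (leafCoord z x) = z x := by
    rintro x ⟨-, hx⟩
    ext (i | i | k)
    · rfl
    · rfl
    · exact (hx k).symm
  have hleaf : ∀ s, ι s ∈ z.target → z.symm (ι s) ∈ casimirLeaf z c ∧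
      leafCoord z (z.symm (ι s)) = s := by
    intro s hs
    have h1 := z.right_inv hs
    refine ⟨⟨z.map_target hs, fun k => by rw [h1]; rfl⟩, ?_⟩
    ext (i | i)
    · change z (z.symm (ι s)) (pIdx i) = _
      rw [h1]; rfl
    · change z (z.symm (ι s)) (qIdx i) = _
      rw [h1]; rfl
  have himage : leafCoord z '' casimirLeaf z c = ι ⁻¹' z.target := by
    ext s
    constructor
    · rintro ⟨x, hx, rfl⟩
      rw [Set.mem_preimage, hιz x hx]
      exact z.map_source hx.1
    · exact fun hs => ⟨_, hleaf s hs⟩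
  have hcoord : ∀ (s : Fin r ⊕ Fin r), ∃ a : Idx r m, ∀ y, leafCoord z y s = z y a := by
    rintro (i | i)
    · exact ⟨pIdx i, fun _ => rfl⟩
    · exact ⟨qIdx i, fun _ => rfl⟩
  have hsm : ContDiffOn ℝ ∞ (leafCoord z) z.source := by
    rw [contDiffOn_pi]
    intro s
    obtain ⟨a, ha⟩ := hcoord s
    simp only [ha]
    exact contDiffOn_pi.1 hz.smooth a
  have hfd : ∀ x ∈ z.source, ∀ v, fderiv ℝ (leafCoord z) x v
      = Sum.elim (fun i => dCoord z (pIdx i) x v) (fun i => dCoord z (qIdx i) x v) := by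
    intro x hx v
    have hd : DifferentiableAt ℝ (leafCoord z) x :=
      (hsm.contDiffAt (z.open_source.mem_nhds hx)).differentiableAt (by simp)
    ext s
    have h1 : fderiv ℝ (fun y => leafCoord z y s) x v = fderiv ℝ (leafCoord z) x v s :=
      congrArg (fun A : (Fin n → ℝ) →L[ℝ] ℝ => A v)
        ((hasFDerivAt_pi'.1 hd.hasFDerivAt s).fderiv)
    rw [← h1]
    rcases s with i | i <;> rfl
  refine ⟨?_, hsm.mono fun x hx => hx.1, ⟨fun s => z.symm (ι s), ?_, ?_⟩, ?_⟩
  · rw [himage]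
    exact z.open_target.preimage hι.continuous
  · rw [himage]
    exact hz.smooth_symm.comp hι.contDiffOn fun s hs => hs
  · intro x hx
    change z.symm (ι (leafCoord z x)) = x
    rw [hιz x hx, z.left_inv hx.1]
  · intro x hx
    have hxs := hx.1
    refine ⟨⟨fun v _ => Set.mem_univ _, ?_, ?_⟩, ?_⟩
    · intro v hv w hw hvw
      rw [hfd x hxs, hfd x hxs] at hvw
      have hp : ∀ i, dCoord z (pIdx i) x v = dCoord z (pIdx i) x w := fun i =>
        congrFun hvw (Sum.inl i)
      have hq : ∀ i, dCoord z (qIdx i) x v = dCoord z (qIdx i) x w := fun i =>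
        congrFun hvw (Sum.inr i)
      rw [← hz.sum_coordVec_leaf hxs hv, ← hz.sum_coordVec_leaf hxs hw]
      exact Finset.sum_congr rfl fun i _ => by rw [hp, hq]
    · intro s _
      refine ⟨∑ i : Fin r, (s (Sum.inl i) • coordVec z (pIdx i) x
        + s (Sum.inr i) • coordVec z (qIdx i) x), ?_, ?_⟩
      · exact Submodule.sum_mem _ fun i _ => Submodule.add_mem _
          (Submodule.smul_mem _ _ (hz.coordVec_mem_leafTangent hxs i).1)
          (Submodule.smul_mem _ _ (hz.coordVec_mem_leafTangent hxs i).2)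
      · rw [hfd x hxs]
        ext (i | i) <;> simp [hz.dCoord_coordVec hxs]
    · intro v _ w _
      rw [cotensorEval_canonicalMetric, hfd x hxs, hfd x hxs]
      simp [Fintype.sum_sum_type, Finset.sum_add_distrib]

end Dissipative

end LieDarboux

theorem mainTheorem5 :
    -- the general case: `n = 2r + m`
    (∀ (n r m : ℕ), n = 2 * r + m →
      ∀ (Ω : Set (Fin n → ℝ)) (J : (Fin n → ℝ) → Matrix (Fin n) (Fin n) ℝ),
      IsOpen Ω → LieDarboux.IsPoissonOn J Ω →
      -- Lie–Darboux coordinates exist near every point around which the rank is `2r`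
      (∀ x₀ ∈ Ω, (∀ᶠ x in 𝓝 x₀, (J x).rank = 2 * r) →
        ∃ z : LieDarboux.Chart n r m,
          x₀ ∈ z.source ∧ z.source ⊆ Ω ∧ LieDarboux.IsLieDarboux J z) ∧
      -- in all Lie–Darboux coordinates
      (∀ z : LieDarboux.Chart n r m, z.source ⊆ Ω → LieDarboux.IsLieDarboux J z →
        (∀ x ∈ z.source,
          -- the form of the dissipative tensor
          LieDarboux.dissipativeTensor J z x = LieDarboux.canonicalContra z x ∧
          -- its inverse along the leaves (without components along the Casimir directions)
          (∀ h : Module.Dual ℝ (Fin n → ℝ) ⊗[ℝ] Module.Dual ℝ (Fin n → ℝ),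
            (LieDarboux.IsInverseOn (LieDarboux.leafTangent z x)
                (LieDarboux.dissipativeTensor J z x) h ∧
              ∀ (k : Fin m) (v : Fin n → ℝ),
                LieDarboux.cotensorEval h
                  (LieDarboux.coordVec z (LieDarboux.cIdx k) x) v = 0 ∧
                LieDarboux.cotensorEval h v
                  (LieDarboux.coordVec z (LieDarboux.cIdx k) x) = 0) ↔
            h = LieDarboux.canonicalMetric z x) ∧
          -- a metric on the leaves
          LieDarboux.IsMetricOn (LieDarboux.leafTangent z x)
            (LieDarboux.canonicalMetric z x)) ∧
        -- which is Euclidean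
        (∀ c : Fin m → ℝ,
          LieDarboux.IsEuclideanOnLeaf z c (LieDarboux.canonicalMetric z)))) ∧
    -- the two-dimensional case `n = 2`, `r = 1`, `m = 0`
    (∀ (J : (Fin 2 → ℝ) → Matrix (Fin 2) (Fin 2) ℝ) (z : LieDarboux.Chart 2 1 0),
      LieDarboux.IsLieDarboux J z → ∀ x ∈ z.source,
        ∃ A : Matrix (Fin 2) (Fin 2) ℝ,
          -- the matrix of `J` in the coordinates `(p, q)`
          A = (LieDarboux.chartComponents J z x).submatrix
            ![LieDarboux.pIdx 0, LieDarboux.qIdx 0] ![LieDarboux.pIdx 0, LieDarboux.qIdx 0] ∧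
          A = !![0, -1; 1, 0] ∧
          LieDarboux.dissipativeMatrix A = -A ^ 2 ∧
          LieDarboux.dissipativeMatrix A = 1 ∧
          LieDarboux.dissipativeTensor J z x =
            LieDarboux.coordVec z (LieDarboux.pIdx 0) x ⊗ₜ[ℝ]
                LieDarboux.coordVec z (LieDarboux.pIdx 0) x
              + LieDarboux.coordVec z (LieDarboux.qIdx 0) x ⊗ₜ[ℝ]
                LieDarboux.coordVec z (LieDarboux.qIdx 0) x ∧
          (∀ h : Module.Dual ℝ (Fin 2 → ℝ) ⊗[ℝ] Module.Dual ℝ (Fin 2 → ℝ),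
            LieDarboux.IsInverseOn ⊤ (LieDarboux.dissipativeTensor J z x) h ↔
            h = LieDarboux.dCoord z (LieDarboux.pIdx 0) x ⊗ₜ[ℝ]
                LieDarboux.dCoord z (LieDarboux.pIdx 0) x
              + LieDarboux.dCoord z (LieDarboux.qIdx 0) x ⊗ₜ[ℝ]
                LieDarboux.dCoord z (LieDarboux.qIdx 0) x) ∧
          LieDarboux.IsMetricOn ⊤
            (LieDarboux.dCoord z (LieDarboux.pIdx 0) x ⊗ₜ[ℝ]
                LieDarboux.dCoord z (LieDarboux.pIdx 0) x
              + LieDarboux.dCoord z (LieDarboux.qIdx 0) x ⊗ₜ[ℝ]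
                LieDarboux.dCoord z (LieDarboux.qIdx 0) x)) := by
  refine ⟨fun n r m hn Ω J hΩ hJ => ⟨fun x₀ hx₀ hrank =>
      LieDarboux.exists_isLieDarboux hn hΩ hJ hx₀ hrank,
    fun z _ hz => ⟨fun x hx => ⟨hz.dissipativeTensor_eq hx, hz.isInverseOn_iff hx,
      hz.isSmoothChart.isMetricOn_canonicalMetric hx⟩,
      hz.isSmoothChart.isEuclideanOnLeaf⟩⟩, fun J z hz x hx => ?_⟩
  -- without Casimir coordinates the plane is its own leaf
  have hT : LieDarboux.leafTangent z x = ⊤ := by simp [LieDarboux.leafTangent]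
  have hcontra : LieDarboux.canonicalContra z x
      = LieDarboux.coordVec z (LieDarboux.pIdx 0) x ⊗ₜ[ℝ]
          LieDarboux.coordVec z (LieDarboux.pIdx 0) x
        + LieDarboux.coordVec z (LieDarboux.qIdx 0) x ⊗ₜ[ℝ]
          LieDarboux.coordVec z (LieDarboux.qIdx 0) x := by
    simp [LieDarboux.canonicalContra]
  have hmetric : LieDarboux.canonicalMetric z x
      = LieDarboux.dCoord z (LieDarboux.pIdx 0) x ⊗ₜ[ℝ]
          LieDarboux.dCoord z (LieDarboux.pIdx 0) x
        + LieDarboux.dCoord z (LieDarboux.qIdx 0) x ⊗ₜ[ℝ]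
          LieDarboux.dCoord z (LieDarboux.qIdx 0) x := by
    simp [LieDarboux.canonicalMetric]
  rw [← hmetric, ← hcontra, ← hT]
  refine ⟨!![0, -1; 1, 0], ?_, rfl, ?_, ?_, hz.dissipativeTensor_eq hx, fun h => ?_,
    hz.isSmoothChart.isMetricOn_canonicalMetric hx⟩
  · ext i j
    rw [Matrix.submatrix_apply, hz.chartComponents_apply hx]
    fin_cases i <;> fin_cases j <;> simp
  · ext i j
    fin_cases i <;> fin_cases j <;>
      simp [LieDarboux.dissipativeMatrix, pow_two]
  · ext i j
    fin_cases i <;> fin_cases j <;> simp [LieDarboux.dissipativeMatrix]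
  · rw [← hz.isInverseOn_iff hx h]
    exact ⟨fun h1 => ⟨h1, fun k => k.elim0⟩, fun h1 => h1.1⟩
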